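/- Let $\mathbb{K}$ be $\mathbb{R}$ or $\mathbb{C}$, let $E$ and $F$ be Banach spaces over $\mathbb{K}$, and let $G$ be a Banach space over $\mathbb{K}$ with an unconditional basis $(g_k)_{k\in\mathbb{N}}$ and coordinate functionals $(g_k')_{k\in\mathbb{N}}$. For an integer $n\ge 1$ let $\mathcal{P}({}^nE;F)$ be the Banach space of continuous $n$-homogeneous polynomials $P:E\to F$ with the norm $\|P\|=\sup_{\|x\|\le 1}\|P(x)\|$, and let $\mathcal{P}_K({}^nE;F)$ (resp. $\mathcal{P}_{wK}({}^nE;F)$) be the subspace of those $P$ that map bounded sets onto relatively compact (resp. relatively weakly compact) sets. A sequence in $F$ is a seminormalized basic sequence if it is a Schauder basis of its closed linear span and its norms lie between two positive constants. A subspace is complemented if it is the range of a bounded linear projection. For a bounded operator $S:E\to G$, let $S':G'\to E'$ denote its adjoint. (a) If there exist bounded linear operators $R:G\to F$ and $S:E\to G$ such that $(R(g_k))_k$ is a seminormalized basic sequence in $F$ and $\{S'(g_k') : k\in\mathbb{N}\}$ is not relatively compact in $E'$ (norm topology), then $\mathcal{P}_K({}^nE;F)$ is not complemented in $\mathcal{P}({}^nE;F)$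 for every $n\ge 1$. (b) If there exist bounded linear operators $R:G\to F$ and $S:E\to G$ such that $(R(g_k))_k$ is a seminormalized basic sequence in $F$ and $\{S'(g_k') : k\in\mathbb{N}\}$ is not relatively weakly compact in $E'$, then $\mathcal{P}_{wK}({}^nE;F)$ is not complemented in $\mathcal{P}({}^nE;F)$ for every $n\ge 1$. -/

import Mathlib

open Set Metric

section WeakAndCompact

/-- A subset of a topological space is relatively compact if its closure is compact. -/
def IsRelativelyCompact {X : Type*} [TopologicalSpace X] (s : Set X) : Prop :=
  IsCompact (closure s)

/-- A subset of a normed space is relatively weakly compact if its closure in the weak topology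
is weakly compact. -/
def IsRelativelyWeaklyCompact (𝕜 : Type*) {X : Type*} [RCLike 𝕜] [NormedAddCommGroup X]
    [NormedSpace 𝕜 X] (s : Set X) : Prop :=
  IsRelativelyCompact (toWeakSpace 𝕜 X '' s)

theorem IsRelativelyCompact.mono {X : Type*} [TopologicalSpace X] {s t : Set X}
    (ht : IsRelativelyCompact t) (h : s ⊆ t) : IsRelativelyCompact s :=
  IsCompact.of_isClosed_subset ht isClosed_closure (closure_mono h)

theorem IsRelativelyCompact.add {X : Type*} [TopologicalSpace X] [AddCommGroup X]
    [IsTopologicalAddGroup X] {s t : Set X}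
    (hs : IsRelativelyCompact s) (ht : IsRelativelyCompact t) :
    IsRelativelyCompact (image2 (· + ·) s t) := by
  have hK : IsCompact (image2 (· + ·) (closure s) (closure t)) := by
    rw [← image_prod]
    exact (hs.prod ht).image continuous_add
  exact hK.closure_of_subset (image2_subset subset_closure subset_closure)

theorem IsRelativelyCompact.image {X Y : Type*} [TopologicalSpace X] [TopologicalSpace Y]
    [R1Space Y] {s : Set X} (hs : IsRelativelyCompact s) {f : X → Y} (hf : Continuous f) :
    IsRelativelyCompact (f '' s) :=
  (IsCompact.image hs hf).closure_of_subset (image_mono subset_closure)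

end WeakAndCompact

section BasicSequences

variable (𝕜 : Type*) {X : Type*} [RCLike 𝕜] [NormedAddCommGroup X] [NormedSpace 𝕜 X]

/-- `x` is a basic sequence: it is a Schauder basis of its closed linear span. -/
def IsBasicSequence (x : ℕ → X) : Prop :=
  ∃ b : SchauderBasis 𝕜 (Submodule.span 𝕜 (range x)).topologicalClosure,
    ∀ k, (b k : X) = x k

/-- `x` is a seminormalized basic sequence. -/
def IsSeminormalizedBasicSequence (x : ℕ → X) : Prop :=
  IsBasicSequence 𝕜 x ∧ ∃ a b : ℝ, 0 < a ∧ ∀ k, a < ‖x k‖ ∧ ‖x k‖ < b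

end BasicSequences

/-- Continuous `n`-homogeneous polynomials `P : E → F`: the maps of the form
`P x = A (x, …, x)` with `A` a continuous `n`-linear map. -/
structure HomogeneousPolynomial (𝕜 : Type*) (n : ℕ) (E F : Type*) [RCLike 𝕜]
    [NormedAddCommGroup E] [NormedSpace 𝕜 E] [NormedAddCommGroup F] [NormedSpace 𝕜 F] where
  toFun : E → F
  exists_multilinear : ∃ A : ContinuousMultilinearMap 𝕜 (fun _ : Fin n => E) F,
    ∀ x, toFun x = A (fun _ => x)

namespace HomogeneousPolynomial

variable {𝕜 : Type*} {n : ℕ} {E F : Type*} [RCLike 𝕜]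
  [NormedAddCommGroup E] [NormedSpace 𝕜 E] [NormedAddCommGroup F] [NormedSpace 𝕜 F]

instance : FunLike (HomogeneousPolynomial 𝕜 n E F) E F where
  coe := toFun
  coe_injective := by
    rintro ⟨f, hf⟩ ⟨g, hg⟩ h
    congr

@[ext]
theorem ext {P Q : HomogeneousPolynomial 𝕜 n E F} (h : ∀ x, P x = Q x) : P = Q :=
  DFunLike.ext P Q h

/-! The vector space structure is the pointwise one. -/

instance : Zero (HomogeneousPolynomial 𝕜 n E F) :=
  ⟨⟨fun _ => 0, 0, fun _ => rfl⟩⟩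

instance : Add (HomogeneousPolynomial 𝕜 n E F) :=
  ⟨fun P Q => ⟨fun x => P x + Q x, by
    obtain ⟨A, hA⟩ := P.exists_multilinear
    obtain ⟨B, hB⟩ := Q.exists_multilinear
    exact ⟨A + B, fun x => congrArg₂ (· + ·) (hA x) (hB x)⟩⟩⟩

instance : Neg (HomogeneousPolynomial 𝕜 n E F) :=
  ⟨fun P => ⟨fun x => -P x, by
    obtain ⟨A, hA⟩ := P.exists_multilinear
    exact ⟨-A, fun x => congrArg (- ·) (hA x)⟩⟩⟩

instance : Sub (HomogeneousPolynomial 𝕜 n E F) :=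
  ⟨fun P Q => ⟨fun x => P x - Q x, by
    obtain ⟨A, hA⟩ := P.exists_multilinear
    obtain ⟨B, hB⟩ := Q.exists_multilinear
    exact ⟨A - B, fun x => congrArg₂ (· - ·) (hA x) (hB x)⟩⟩⟩

instance : SMul 𝕜 (HomogeneousPolynomial 𝕜 n E F) :=
  ⟨fun c P => ⟨fun x => c • P x, by
    obtain ⟨A, hA⟩ := P.exists_multilinear
    exact ⟨c • A, fun x => congrArg (c • ·) (hA x)⟩⟩⟩

instance : SMul ℕ (HomogeneousPolynomial 𝕜 n E F) :=
  ⟨fun c P => ⟨fun x => c • P x, by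
    obtain ⟨A, hA⟩ := P.exists_multilinear
    exact ⟨c • A, fun x => congrArg (c • ·) (hA x)⟩⟩⟩

instance : SMul ℤ (HomogeneousPolynomial 𝕜 n E F) :=
  ⟨fun c P => ⟨fun x => c • P x, by
    obtain ⟨A, hA⟩ := P.exists_multilinear
    exact ⟨c • A, fun x => congrArg (c • ·) (hA x)⟩⟩⟩

@[simp] theorem zero_apply (x : E) : (0 : HomogeneousPolynomial 𝕜 n E F) x = 0 := rfl

@[simp] theorem add_apply (P Q : HomogeneousPolynomial 𝕜 n E F) (x : E) :
    (P + Q) x = P x + Q x := rfl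

@[simp] theorem smul_apply (c : 𝕜) (P : HomogeneousPolynomial 𝕜 n E F) (x : E) :
    (c • P) x = c • P x := rfl

instance : AddCommGroup (HomogeneousPolynomial 𝕜 n E F) :=
  DFunLike.coe_injective.addCommGroup (fun P : HomogeneousPolynomial 𝕜 n E F => (P : E → F))
    rfl (fun _ _ => rfl) (fun _ => rfl) (fun _ _ => rfl) (fun _ _ => rfl) (fun _ _ => rfl)

instance : Module 𝕜 (HomogeneousPolynomial 𝕜 n E F) :=
  DFunLike.coe_injective.module 𝕜
    { toFun := fun P : HomogeneousPolynomial 𝕜 n E F => (P : E → F)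
      map_zero' := rfl
      map_add' := fun _ _ => rfl } (fun _ _ => rfl)

theorem map_smul_pow (P : HomogeneousPolynomial 𝕜 n E F) (c : 𝕜) (x : E) :
    P (c • x) = c ^ n • P x := by
  obtain ⟨A, hA⟩ := P.exists_multilinear
  have h := A.map_smul_univ (fun _ => c) (fun _ => x)
  simp only [Finset.prod_const, Finset.card_univ, Fintype.card_fin] at h
  exact (hA _).trans (h.trans (congrArg _ (hA x).symm))

/-- The usual norm `‖P‖ = sup {‖P x‖ : ‖x‖ ≤ 1}`. -/
noncomputable instance : Norm (HomogeneousPolynomial 𝕜 n E F) :=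
  ⟨fun P => ⨆ x : closedBall (0 : E) 1, ‖P x‖⟩

theorem norm_def (P : HomogeneousPolynomial 𝕜 n E F) :
    ‖P‖ = ⨆ x : closedBall (0 : E) 1, ‖P x‖ := rfl

theorem bddAbove_range (P : HomogeneousPolynomial 𝕜 n E F) :
    BddAbove (range fun x : closedBall (0 : E) 1 => ‖P x‖) := by
  obtain ⟨A, hA⟩ := P.exists_multilinear
  refine ⟨‖A‖, ?_⟩
  rintro _ ⟨⟨x, hx⟩, rfl⟩
  have hx' : ‖x‖ ≤ 1 := by simpa using hx
  have h := A.le_opNorm (fun _ => x)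
  rw [← hA x] at h
  refine h.trans (mul_le_of_le_one_right (norm_nonneg _) ?_)
  exact Finset.prod_le_one (fun _ _ => norm_nonneg _) (fun _ _ => hx')

theorem le_norm (P : HomogeneousPolynomial 𝕜 n E F) {x : E} (hx : ‖x‖ ≤ 1) : ‖P x‖ ≤ ‖P‖ :=
  le_ciSup P.bddAbove_range ⟨x, by simpa using hx⟩

theorem norm_core : NormedSpace.Core 𝕜 (HomogeneousPolynomial 𝕜 n E F) where
  norm_nonneg P := Real.iSup_nonneg fun _ => norm_nonneg _
  norm_smul c P := by
    simp only [norm_def, smul_apply, norm_smul]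
    exact (Real.mul_iSup_of_nonneg (norm_nonneg c) _).symm
  norm_triangle P Q := by
    have : Nonempty (closedBall (0 : E) 1) := ⟨⟨0, by simp⟩⟩
    refine ciSup_le fun x => ?_
    have hx : ‖(x : E)‖ ≤ 1 := mem_closedBall_zero_iff.1 x.2
    exact (norm_add_le _ _).trans (add_le_add (P.le_norm hx) (Q.le_norm hx))
  norm_eq_zero_iff P := by
    constructor
    · intro h
      have h1 : ∀ y : E, ‖y‖ ≤ 1 → P y = 0 := fun y hy =>
        norm_le_zero_iff.1 ((P.le_norm hy).trans h.le)
      ext x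
      have hpos : (0 : ℝ) < ‖x‖ + 1 := by positivity
      have hc : ((‖x‖ + 1 : ℝ) : 𝕜) ≠ 0 := RCLike.ofReal_ne_zero.2 hpos.ne'
      have hx : x = ((‖x‖ + 1 : ℝ) : 𝕜) • (((‖x‖ + 1 : ℝ) : 𝕜)⁻¹ • x) := by
        rw [smul_smul, mul_inv_cancel₀ hc, one_smul]
      rw [hx, map_smul_pow, h1, smul_zero, zero_apply]
      rw [norm_smul, norm_inv, RCLike.norm_ofReal, abs_of_pos hpos, inv_mul_le_iff₀ hpos]
      linarith
    · rintro rfl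
      simp [norm_def]

/-- `P(ⁿE; F)` as a normed space. -/
noncomputable instance : NormedAddCommGroup (HomogeneousPolynomial 𝕜 n E F) :=
  NormedAddCommGroup.ofCore norm_core

noncomputable instance : NormedSpace 𝕜 (HomogeneousPolynomial 𝕜 n E F) :=
  NormedSpace.ofCore norm_core

variable (𝕜 n E F)

/-- `P_K(ⁿE; F)`: the polynomials mapping bounded sets onto relatively compact sets. -/
def compactPolynomials : Submodule 𝕜 (HomogeneousPolynomial 𝕜 n E F) where
  carrier := {P | ∀ B : Set E, Bornology.IsBounded B → IsRelativelyCompact (P '' B)}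
  zero_mem' := fun B _ => by
    refine IsRelativelyCompact.mono (t := {0}) ?_ ?_
    · simp [IsRelativelyCompact]
    · rintro _ ⟨x, -, rfl⟩
      rfl
  add_mem' := fun {P Q} hP hQ B hB => by
    refine ((hP B hB).add (hQ B hB)).mono ?_
    rintro _ ⟨x, hx, rfl⟩
    exact ⟨P x, ⟨x, hx, rfl⟩, Q x, ⟨x, hx, rfl⟩, rfl⟩
  smul_mem' := fun c P hP B hB => by
    refine ((hP B hB).image (continuous_const_smul c)).mono ?_
    rintro _ ⟨x, hx, rfl⟩
    exact ⟨P x, ⟨x, hx, rfl⟩, rfl⟩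

/-- `P_wK(ⁿE; F)`: the polynomials mapping bounded sets onto relatively weakly compact sets. -/
def weaklyCompactPolynomials : Submodule 𝕜 (HomogeneousPolynomial 𝕜 n E F) where
  carrier := {P | ∀ B : Set E, Bornology.IsBounded B → IsRelativelyWeaklyCompact 𝕜 (P '' B)}
  zero_mem' := fun B _ => by
    refine IsRelativelyCompact.mono (t := {0}) ?_ ?_
    · simp [IsRelativelyCompact]
    · rintro _ ⟨_, ⟨x, -, rfl⟩, rfl⟩
      exact map_zero (toWeakSpace 𝕜 F)
  add_mem' := fun {P Q} hP hQ B hB => by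
    refine (IsRelativelyCompact.add (hP B hB) (hQ B hB)).mono ?_
    rintro _ ⟨_, ⟨x, hx, rfl⟩, rfl⟩
    exact ⟨_, ⟨P x, ⟨x, hx, rfl⟩, rfl⟩, _, ⟨Q x, ⟨x, hx, rfl⟩, rfl⟩,
      (map_add (toWeakSpace 𝕜 F) _ _).symm⟩
  smul_mem' := fun c P hP B hB => by
    refine (IsRelativelyCompact.image (hP B hB) (continuous_const_smul c)).mono ?_
    rintro _ ⟨_, ⟨x, hx, rfl⟩, rfl⟩
    exact ⟨_, ⟨P x, ⟨x, hx, rfl⟩, rfl⟩, (map_smul (toWeakSpace 𝕜 F) _ _).symm⟩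

end HomogeneousPolynomial

/-! Write `a k = S'(g_k')`. Unconditionality gives uniformly bounded coordinate projections `P s`,
`s ⊆ ℕ`, and hence operators `T s = R ∘ P s ∘ S` that are finitely additive in `s` and of finite
rank for finite `s`. Bounded functionals `h k` biorthogonal to `R (g k)` recover `a k` from `T s`
exactly when `k ∈ s` (`exists_operator_family`).

A projection onto the small (compact or weakly compact) polynomials would yield a map `Ψ` on
operators, with small values and fixing small operators: multiply by `φ^m`, project, and
differentiate at a point `e` with `φ e = 1` (`exists_linear_of_closedComplemented`). For fixed `k`
and `x`, the defect `h k (Ψ (T s) x) - h k (T s x)` is a bounded finitely additive function of `s`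
that vanishes on finite sets. Each such function is nonzero on at most countably many members of an
almost disjoint family, and `ℕ` carries an uncountable one. So a single infinite `s` kills countably
many defects at once (`exists_infinite_forall_eq_zero`).

Testing on a countable set norming the span of the `a k`, one finds that along `s` the `a k` are
dominated, for all linear combinations, by the `h k ∘ K` with `K = Ψ (T s)` small
(`exists_operator_dominating`). If `K` is compact, the `h k ∘ K` have no norm-separated subsequence;
if `K` is weakly compact, they have no subsequence with separated successive convex blocks
(`exists_norm_comp_sub_lt`, `exists_convexHull_norm_sub_lt`). The failure of (weak) compactness of
the `a k` provides just such separation, which passes through the domination: a contradiction. -/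

/-! ### Almost disjoint families and bounded finitely additive set functions. -/

section AlmostDisjoint

/-- The codes of the finite initial segments of a binary sequence. -/
def branchCodes (σ : ℕ → Bool) : Set ℕ :=
  range fun n => Encodable.encode (List.ofFn fun i : Fin n => σ i)

theorem branchCodes_infinite (σ : ℕ → Bool) : (branchCodes σ).Infinite := by
  refine infinite_range_of_injective fun m n h => ?_
  have := congrArg List.length (Encodable.encode_injective h)
  simpa using this

/-- Branches of the binary tree that differ at `k` share only initial segments of length at most
`k`. -/
theorem finite_branchCodes_inter {σ τ : ℕ → Bool} (h : σ ≠ τ) :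
    (branchCodes σ ∩ branchCodes τ).Finite := by
  obtain ⟨k, hk⟩ := Function.ne_iff.1 h
  refine ((finite_Iic k).image
    fun n => Encodable.encode (List.ofFn fun i : Fin n => σ i)).subset ?_
  rintro _ ⟨⟨m, rfl⟩, n, hn⟩
  refine ⟨m, ?_, rfl⟩
  have h1 := Encodable.encode_injective hn
  have h2 : n = m := by simpa using congrArg List.length h1
  subst h2
  by_contra hlt
  have h3 := congrFun (List.ofFn_injective h1) ⟨k, not_le.1 hlt⟩
  exact hk h3.symm

section

variable {A : Type*} [AddCommGroup A] {ν : Set ℕ → A}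

theorem additive_union_of_finite_inter
    (hadd : ∀ s t, Disjoint s t → ν (s ∪ t) = ν s + ν t)
    (hfin : ∀ s : Set ℕ, s.Finite → ν s = 0) {s t : Set ℕ} (hst : (s ∩ t).Finite) :
    ν (s ∪ t) = ν s + ν t := by
  have h1 := hadd (s \ t) t disjoint_sdiff_left
  have h2 := hadd (s \ t) (s ∩ t) (disjoint_sdiff_inter)
  rw [sdiff_union_self] at h1
  rw [sdiff_union_inter, hfin _ hst, add_zero] at h2
  rw [h1, h2]

theorem additive_biUnion_of_finite_inter {α : Type*} {M : α → Set ℕ}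
    (hadd : ∀ s t, Disjoint s t → ν (s ∪ t) = ν s + ν t)
    (hfin : ∀ s : Set ℕ, s.Finite → ν s = 0)
    (hM : ∀ a b, a ≠ b → (M a ∩ M b).Finite) (S : Finset α) :
    ν (⋃ a ∈ S, M a) = ∑ a ∈ S, ν (M a) := by
  classical
  induction S using Finset.induction_on with
  | empty => simpa using hfin ∅ finite_empty
  | insert a S ha ih =>
    rw [Finset.set_biUnion_insert, Finset.sum_insert ha, ← ih]
    refine additive_union_of_finite_inter hadd hfin ?_
    rw [inter_iUnion₂]
    refine S.finite_toSet.biUnion fun b hb => hM a b ?_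
    rintro rfl
    exact ha hb

end

/-- Finite overlaps are null, so a finite sum of values `ν (M a)` is the value at a union and is at
most `C`. The positive values are therefore summable, and a summable family has countable support.
-/
theorem countable_pos_of_almostDisjoint {α : Type*} {M : α → Set ℕ} {ν : Set ℕ → ℝ}
    (hadd : ∀ s t, Disjoint s t → ν (s ∪ t) = ν s + ν t)
    (hfin : ∀ s : Set ℕ, s.Finite → ν s = 0) {C : ℝ} (hC : ∀ s, ν s ≤ C)
    (hM : ∀ a b, a ≠ b → (M a ∩ M b).Finite) : {a | 0 < ν (M a)}.Countable := by
  have hs : Summable fun a : {a | 0 < ν (M a)} => ν (M a) := by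
    refine summable_of_sum_le (fun a => a.2.le) (c := C) fun S => ?_
    rw [← additive_biUnion_of_finite_inter (M := fun a : {a | 0 < ν (M a)} => M a) hadd hfin]
    · exact hC _
    · exact fun a b hab => hM a b (Subtype.coe_injective.ne hab)
  have h2 := hs.countable_support
  rw [Function.support_eq_univ fun a => a.2.ne'] at h2
  exact countable_coe_iff.1 (countable_univ_iff.1 h2)

theorem countable_ne_zero_of_almostDisjoint {𝕜 : Type*} [RCLike 𝕜] {α : Type*} {M : α → Set ℕ}
    {μ : Set ℕ → 𝕜} (hadd : ∀ s t, Disjoint s t → μ (s ∪ t) = μ s + μ t)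
    (hfin : ∀ s : Set ℕ, s.Finite → μ s = 0) {C : ℝ} (hC : ∀ s, ‖μ s‖ ≤ C)
    (hM : ∀ a b, a ≠ b → (M a ∩ M b).Finite) : {a | μ (M a) ≠ 0}.Countable := by
  have key : ∀ l : 𝕜 →+ ℝ, (∀ z, |l z| ≤ ‖z‖) → {a | l (μ (M a)) ≠ 0}.Countable := by
    intro l hl
    have h1 := countable_pos_of_almostDisjoint (ν := fun s => l (μ s)) (C := C) (M := M)
      (fun s t h => by simp [hadd s t h]) (fun s h => by simp [hfin s h])
      (fun s => (le_abs_self _).trans ((hl _).trans (hC s))) hM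
    have h2 := countable_pos_of_almostDisjoint (ν := fun s => -l (μ s)) (C := C) (M := M)
      (fun s t h => by simp [hadd s t h, add_comm]) (fun s h => by simp [hfin s h])
      (fun s => (neg_le_abs _).trans ((hl _).trans (hC s))) hM
    refine (h1.union h2).mono fun a ha => ?_
    rcases lt_or_gt_of_ne ha with h | h
    · exact Or.inr (neg_pos.2 h)
    · exact Or.inl h
  refine ((key RCLike.re RCLike.abs_re_le_norm).union
    (key RCLike.im RCLike.abs_im_le_norm)).mono fun a ha => ?_
  by_contra hcon
  simp only [mem_union, mem_ofPred_eq, not_or, not_not] at hcon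
  exact ha (RCLike.ext (by simpa using hcon.1) (by simpa using hcon.2))

/-- There are uncountably many branches, and each of the countably many `μ i` excludes only
countably many of them. -/
theorem exists_infinite_forall_eq_zero {𝕜 : Type*} [RCLike 𝕜] {ι : Type*} [Countable ι]
    {μ : ι → Set ℕ → 𝕜} (hadd : ∀ i s t, Disjoint s t → μ i (s ∪ t) = μ i s + μ i t)
    (hfin : ∀ i (s : Set ℕ), s.Finite → μ i s = 0) (hC : ∀ i, ∃ C : ℝ, ∀ s, ‖μ i s‖ ≤ C) :
    ∃ s : Set ℕ, s.Infinite ∧ ∀ i, μ i s = 0 := by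
  have hcount : (⋃ i, {σ | μ i (branchCodes σ) ≠ 0}).Countable := by
    refine countable_iUnion fun i => ?_
    obtain ⟨C, hC⟩ := hC i
    exact countable_ne_zero_of_almostDisjoint (hadd i) (hfin i) hC
      fun _ _ => finite_branchCodes_inter
  obtain ⟨σ, hσ⟩ : ∃ σ, σ ∉ ⋃ i, {σ | μ i (branchCodes σ) ≠ 0} := by
    by_contra! hcon
    rw [eq_univ_of_forall hcon, countable_univ_iff] at hcount
    -- Cantor's diagonal argument: the binary sequences are uncountable.
    obtain ⟨e, he⟩ := exists_surjective_nat (ℕ → Bool)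
    obtain ⟨n, hn⟩ := he fun n => !e n n
    simpa using congrFun hn n
  refine ⟨branchCodes σ, branchCodes_infinite σ, fun i => ?_⟩
  by_contra hi
  exact hσ (mem_iUnion.2 ⟨i, hi⟩)

end AlmostDisjoint

/-! ### Countable norming sets. -/

section Norming

variable {𝕜 : Type*} [RCLike 𝕜] {E : Type*} [NormedAddCommGroup E] [NormedSpace 𝕜 E]

theorem ContinuousLinearMap.exists_half_norm_le (f : StrongDual 𝕜 E) :
    ∃ x : E, ‖x‖ ≤ 1 ∧ ‖f‖ ≤ 2 * ‖f x‖ := by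
  by_cases hf : f = 0
  · exact ⟨0, by simp, by simp [hf]⟩
  have hpos : 0 < ‖f‖ := norm_pos_iff.2 hf
  obtain ⟨x, hx, hfx⟩ := f.exists_lt_apply_of_lt_opNorm (half_lt_self hpos)
  exact ⟨x, hx.le, by linarith⟩

/-- The span of a sequence of functionals has a countable norming set. -/
theorem exists_seq_norming (a : ℕ → StrongDual 𝕜 E) :
    ∃ x : ℕ → E, ∀ f ∈ Submodule.span 𝕜 (range a), ∀ g : StrongDual 𝕜 E,
      (∀ i, g (x i) = f (x i)) → ‖f‖ ≤ 4 * ‖g‖ := by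
  have hsep : TopologicalSpace.IsSeparable (Submodule.span 𝕜 (range a) : Set (StrongDual 𝕜 E)) :=
    (countable_range a).isSeparable.span
  obtain ⟨c, hc, hsub⟩ := hsep
  have hne : c.Nonempty := closure_nonempty_iff.1 ⟨0, hsub (Submodule.zero_mem _)⟩
  obtain ⟨d, rfl⟩ := hc.exists_eq_range hne
  choose x hx hdx using fun i => (d i).exists_half_norm_le
  refine ⟨x, fun f hf g hg => ?_⟩
  by_cases hf0 : f = 0
  · simp [hf0]
  have hpos : 0 < ‖f‖ := norm_pos_iff.2 hf0
  -- With error `r = ‖f - d i‖` the estimates below give `‖f‖ ≤ 2‖g‖ + 3r`; taking `r < ‖f‖ / 6`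
  -- absorbs the error at the cost of the final constant 4.
  obtain ⟨_, ⟨i, rfl⟩, hi⟩ := Metric.mem_closure_iff.1 (hsub hf) (‖f‖ / 6) (by positivity)
  rw [dist_eq_norm] at hi
  have h1 : ‖(f - d i) (x i)‖ ≤ ‖f - d i‖ := by
    simpa using (f - d i).le_of_opNorm_le_of_le le_rfl (hx i)
  have h2 : ‖g (x i)‖ ≤ ‖g‖ := by simpa using g.le_of_opNorm_le_of_le le_rfl (hx i)
  have h3 : ‖d i (x i)‖ ≤ ‖g (x i)‖ + ‖(f - d i) (x i)‖ := by
    have : d i (x i) = g (x i) - (f - d i) (x i) := by simp [hg]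
    rw [this]
    exact norm_sub_le _ _
  have h4 : ‖f‖ ≤ ‖d i‖ + ‖f - d i‖ := by
    simpa using norm_add_le (d i) (f - d i)
  have h5 := hdx i
  linarith

end Norming

/-! ### Weak compactness, biduals and separation of convex blocks. -/

section Weak

open scoped Pointwise

variable {𝕜 : Type*} [RCLike 𝕜]

theorem WeakDual.isScalarTower_real {X : Type*} [NormedAddCommGroup X] [NormedSpace 𝕜 X] :
    IsScalarTower ℝ 𝕜 (WeakDual 𝕜 X) :=
  inferInstanceAs (IsScalarTower ℝ 𝕜 (X →L[𝕜] 𝕜))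

theorem WeakDual.real_smul_eq_coe_smul {X : Type*} [NormedAddCommGroup X] [NormedSpace 𝕜 X]
    (r : ℝ) (w : WeakDual 𝕜 X) : r • w = (r : 𝕜) • w := by
  have := WeakDual.isScalarTower_real (𝕜 := 𝕜) (X := X)
  exact RCLike.real_smul_eq_coe_smul r w

theorem WeakDual.locallyConvexSpace_real {X : Type*} [NormedAddCommGroup X] [NormedSpace 𝕜 X] :
    LocallyConvexSpace ℝ (WeakDual 𝕜 X) :=
  LocallyConvexSpace.induced
    ({ toFun := fun f x => f x, map_add' := fun _ _ => rfl, map_smul' := fun _ _ => rfl } :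
      WeakDual 𝕜 X →ₗ[ℝ] (X → 𝕜))

/-- A point is separated from a weak-star closed convex set by a weak-star continuous
functional, that is by an element of the predual. -/
theorem WeakDual.exists_re_lt_of_notMem {X : Type*} [NormedAddCommGroup X] [NormedSpace 𝕜 X]
    {C : Set (WeakDual 𝕜 X)} (hconv : Convex ℝ C) (hC : IsClosed C) {z : WeakDual 𝕜 X}
    (hz : z ∉ C) :
    ∃ (f : X) (u : ℝ), (∀ c ∈ C, RCLike.re (c f) < u) ∧ u < RCLike.re (z f) := by
  have := WeakDual.isScalarTower_real (𝕜 := 𝕜) (X := X)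
  have := WeakDual.locallyConvexSpace_real (𝕜 := 𝕜) (X := X)
  have key : ∃ (l : StrongDual 𝕜 (WeakDual 𝕜 X)) (u : ℝ),
      (∀ c ∈ C, RCLike.re (l c) < u) ∧ u < RCLike.re (l z) :=
    RCLike.geometric_hahn_banach_closed_point (𝕜 := 𝕜) (E := WeakDual 𝕜 X) hconv hC hz
  obtain ⟨l, u, h1, h2⟩ := key
  obtain ⟨f, hf⟩ := LinearMap.dualEmbedding_surjective (topDualPairing 𝕜 X) l
  have hlf : ∀ w : WeakDual 𝕜 X, l w = w f := fun w => (DFunLike.congr_fun hf w).symm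
  exact ⟨f, u, fun c hc => hlf c ▸ h1 c hc, hlf z ▸ h2⟩

/-- Balls are invariant under unimodular scalars, so the real part of `g` has the same supremum
there as its modulus. -/
theorem ContinuousLinearMap.mul_norm_le_of_re_le {E : Type*} [NormedAddCommGroup E]
    [NormedSpace 𝕜 E] (g : StrongDual 𝕜 E) {r u : ℝ} (hr : 0 ≤ r)
    (h : ∀ x : E, ‖x‖ ≤ r → RCLike.re (g x) ≤ u) : r * ‖g‖ ≤ u := by
  have hu : 0 ≤ u := by simpa using h 0 (by simpa using hr)
  have key : ∀ x : E, r * ‖g x‖ ≤ u * ‖x‖ := by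
    intro x
    by_cases hx : x = 0
    · simp [hx]
    have hx' : 0 < ‖x‖ := norm_pos_iff.2 hx
    obtain ⟨c, hc, hcx⟩ := RCLike.exists_norm_eq_mul_self (g x)
    have h1 := h (((r / ‖x‖ : ℝ) : 𝕜) • c • x) (by
      rw [norm_smul, norm_smul, hc, one_mul, RCLike.norm_ofReal, abs_of_nonneg (by positivity),
        div_mul_cancel₀ _ hx'.ne'])
    rw [g.map_smul, g.map_smul, smul_eq_mul, smul_eq_mul, ← hcx, ← RCLike.ofReal_mul,
      RCLike.ofReal_re, div_mul_eq_mul_div, div_le_iff₀ hx'] at h1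
    exact h1
  rcases hr.eq_or_lt with rfl | hr
  · simpa using hu
  have h2 : ‖g‖ ≤ u / r := g.opNorm_le_bound (by positivity) fun x => by
    rw [div_mul_eq_mul_div, le_div_iff₀ hr, mul_comm]
    exact key x
  rwa [le_div_iff₀ hr, mul_comm] at h2

theorem mul_norm_le_of_forall_dual {Y : Type*} [NormedAddCommGroup Y] [NormedSpace 𝕜 Y] {f : Y}
    {r u : ℝ} (hr : 0 ≤ r) (h : ∀ b : StrongDual 𝕜 Y, ‖b‖ ≤ r → RCLike.re (b f) ≤ u) :
    r * ‖f‖ ≤ u := by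
  obtain ⟨g, hg, hgf⟩ := exists_dual_vector'' 𝕜 f
  have h1 := h ((r : 𝕜) • g) (by
    rw [norm_smul, RCLike.norm_ofReal, abs_of_nonneg hr]
    exact mul_le_of_le_one_right hr hg)
  rwa [smul_apply, hgf, smul_eq_mul, ← RCLike.ofReal_mul,
    RCLike.ofReal_re] at h1

/-- The bitranspose of a weakly compact operator takes its values in the codomain. -/
theorem exists_eval_of_isRelativelyWeaklyCompact {E F : Type*} [NormedAddCommGroup E]
    [NormedSpace 𝕜 E] [NormedAddCommGroup F] [NormedSpace 𝕜 F] {K : E →L[𝕜] F}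
    (hK : ∀ r : ℝ, IsRelativelyWeaklyCompact 𝕜 (K '' closedBall 0 r))
    (φ : StrongDual 𝕜 (StrongDual 𝕜 E)) :
    ∃ y : F, ∀ f : StrongDual 𝕜 F, φ (f.comp K) = f y := by
  let J := NormedSpace.inclusionInDoubleDualWeak 𝕜 F
  let W : Set (WeakSpace 𝕜 F) := toWeakSpace 𝕜 F '' (K '' closedBall 0 ‖φ‖)
  have hsub : closure (J '' W) ⊆ J '' closure W :=
    closure_minimal (image_mono subset_closure)
      (IsCompact.image (hK ‖φ‖) J.continuous).isClosed
  have hconv : Convex ℝ (J '' W) := by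
    rintro _ ⟨_, ⟨_, ⟨x, hx, rfl⟩, rfl⟩, rfl⟩ _ ⟨_, ⟨_, ⟨y, hy, rfl⟩, rfl⟩, rfl⟩ s t hs ht hst
    refine ⟨_, ⟨_, ⟨(s : 𝕜) • x + (t : 𝕜) • y, ?_, rfl⟩, rfl⟩, ?_⟩
    · rw [mem_closedBall_zero_iff] at hx hy ⊢
      calc _ ≤ ‖(s : 𝕜) • x‖ + ‖(t : 𝕜) • y‖ := norm_add_le _ _
        _ = s * ‖x‖ + t * ‖y‖ := by
          rw [norm_smul, norm_smul, RCLike.norm_ofReal, RCLike.norm_ofReal, abs_of_nonneg hs,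
            abs_of_nonneg ht]
        _ ≤ s * ‖φ‖ + t * ‖φ‖ := by gcongr
        _ = ‖φ‖ := by rw [← add_mul, hst, one_mul]
    · simp only [map_add, map_smul, WeakDual.real_smul_eq_coe_smul]
  let z : WeakDual 𝕜 (StrongDual 𝕜 F) :=
    StrongDual.toWeakDual (φ.comp ((ContinuousLinearMap.compL 𝕜 E F 𝕜).flip K))
  have hz : ∀ f : StrongDual 𝕜 F, z f = φ (f.comp K) := fun f => rfl
  by_cases hmem : z ∈ closure (J '' W)
  · obtain ⟨w, -, hw⟩ := hsub hmem
    refine ⟨(toWeakSpace 𝕜 F).symm w, fun f => ?_⟩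
    rw [← hz f, ← hw]
    rfl
  -- Goldstine's argument: a separating `f` would satisfy `‖φ‖ * ‖f ∘ K‖ ≤ u < re (φ (f ∘ K))`,
  -- which is impossible. This is why the ball in `W` has radius `‖φ‖`.
  obtain ⟨f, u, h1, h2⟩ := WeakDual.exists_re_lt_of_notMem
    (Convex.closure (𝕜 := ℝ) (E := WeakDual 𝕜 (StrongDual 𝕜 F)) hconv) isClosed_closure hmem
  have h3 := (f.comp K).mul_norm_le_of_re_le (norm_nonneg φ) (u := u) fun x hx =>
    (h1 _ (subset_closure ⟨_, ⟨_, ⟨x, by simpa using hx, rfl⟩, rfl⟩, rfl⟩)).le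
  rw [hz] at h2
  have h4 := (RCLike.re_le_norm _).trans (φ.le_opNorm (f.comp K))
  linarith

/-- A bounded sequence of functionals, composed with a weakly compact operator, has no
subsequence whose successive convex blocks are separated. -/
theorem exists_convexHull_norm_sub_lt {E F : Type*} [NormedAddCommGroup E]
    [NormedSpace 𝕜 E] [NormedAddCommGroup F] [NormedSpace 𝕜 F] {K : E →L[𝕜] F}
    (hK : ∀ r : ℝ, IsRelativelyWeaklyCompact 𝕜 (K '' closedBall 0 r))
    {h : ℕ → StrongDual 𝕜 F} {C : ℝ} (hC : ∀ k, ‖h k‖ ≤ C) {δ : ℝ} (hδ : 0 < δ) :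
    ∃ n : ℕ, ∃ x ∈ convexHull ℝ ((fun k => (h k).comp K) '' Iio n),
      ∃ y ∈ convexHull ℝ ((fun k => (h k).comp K) '' Ici n), ‖x - y‖ < δ := by
  obtain ⟨H, -, hH⟩ := (WeakDual.isCompact_closedBall (0 : StrongDual 𝕜 F) C).exists_mapClusterPt
    (f := Filter.atTop) (u := fun k => StrongDual.toWeakDual (h k)) (by
      rw [Filter.le_principal_iff, Filter.mem_map]
      filter_upwards with k
      simpa using hC k)
  -- A functional `φ` on `E'` acts on `f ∘ K` as evaluation of `f` at some `y` in `F`. Weak-star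
  -- clustering of `h k` at `H` thus becomes weak clustering of `h k ∘ K` at `H ∘ K`, and
  -- Hahn–Banach upgrades this to norm approximation by convex combinations of any tail.
  have key : ∀ n : ℕ, (WeakDual.toStrongDual H).comp K ∈
      closure (convexHull ℝ ((fun k => (h k).comp K) '' Ici n)) := by
    intro n
    by_contra hcon
    obtain ⟨φ, u, h1, h2⟩ := RCLike.geometric_hahn_banach_closed_point (𝕜 := 𝕜)
      (convex_convexHull ℝ _).closure isClosed_closure hcon
    obtain ⟨y, hy⟩ := exists_eval_of_isRelativelyWeaklyCompact hK φ
    rw [hy] at h2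
    have hopen : IsOpen {g : WeakDual 𝕜 F | u < RCLike.re (g y)} :=
      isOpen_lt continuous_const
        (RCLike.continuous_re.comp (WeakDual.eval_continuous y))
    have hfr := (mapClusterPt_iff_frequently.1 hH) _ (hopen.mem_nhds h2)
    obtain ⟨k, hk, hk2⟩ := (hfr.and_eventually (Filter.eventually_ge_atTop n)).exists
    have h3 := h1 _ (subset_closure (subset_convexHull ℝ _ ⟨k, hk2, rfl⟩))
    rw [hy] at h3
    exact lt_asymm h3 hk
  obtain ⟨x, hx, hxd⟩ := Metric.mem_closure_iff.1 (key 0) (δ / 2) (half_pos hδ)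
  -- A convex combination uses finitely many indices; the second block starts beyond them.
  obtain ⟨n, hn⟩ : ∃ n : ℕ, x ∈ convexHull ℝ ((fun k => (h k).comp K) '' Iio n) := by
    rw [convexHull_eq_union_convexHull_finite_subsets] at hx
    simp only [mem_iUnion] at hx
    obtain ⟨t, ht, hxt⟩ := hx
    have ht' : ∀ z ∈ t, ∃ k, (h k).comp K = z := fun z hz => by
      obtain ⟨k, -, hk⟩ := ht hz
      exact ⟨k, hk⟩
    choose! k hk using ht'
    obtain ⟨n, hn⟩ := (t.image k).bddAbove
    have hsub : (t : Set (StrongDual 𝕜 E)) ⊆ (fun k => (h k).comp K) '' Iio (n + 1) :=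
      fun z hz => ⟨k z, Nat.lt_succ_of_le (hn (Finset.mem_coe.2
        (Finset.mem_image_of_mem k (Finset.mem_coe.1 hz)))), hk z hz⟩
    exact ⟨n + 1, convexHull_mono hsub hxt⟩
  obtain ⟨y, hy, hyd⟩ := Metric.mem_closure_iff.1 (key n) (δ / 2) (half_pos hδ)
  refine ⟨n, x, hn, y, hy, ?_⟩
  rw [← dist_eq_norm]
  linarith [dist_triangle_left x y ((WeakDual.toStrongDual H).comp K)]

/-- The hull of a finite set plus the `θ`-ball of the bidual is weak-star compact and convex, and
misses `z`. The ball contributes `θ * ‖f‖` to the supremum of the separating functional, hence the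
quantitative gap. -/
theorem exists_weakDual_separation {X : Type*} [NormedAddCommGroup X] [NormedSpace 𝕜 X]
    [NormedSpace ℝ X] [IsScalarTower ℝ 𝕜 X] {z : StrongDual 𝕜 (StrongDual 𝕜 X)} {θ : ℝ}
    (hz : ∀ x : X, θ < ‖z - NormedSpace.inclusionInDoubleDual 𝕜 X x‖) (hθ : 0 ≤ θ)
    {s : Set X} (hs : s.Finite) :
    ∃ (f : StrongDual 𝕜 X) (u : ℝ), (∀ x ∈ convexHull ℝ s, RCLike.re (f x) + θ * ‖f‖ ≤ u) ∧
      u < RCLike.re (z f) := by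
  let J := NormedSpace.inclusionInDoubleDualWeak 𝕜 X
  let C : Set (WeakDual 𝕜 (StrongDual 𝕜 X)) := J '' (toWeakSpace 𝕜 X '' convexHull ℝ s)
  let B : Set (WeakDual 𝕜 (StrongDual 𝕜 X)) := WeakDual.toStrongDual ⁻¹' closedBall 0 θ
  have hB : ∀ w, w ∈ B ↔ ‖WeakDual.toStrongDual w‖ ≤ θ := fun w =>
    mem_closedBall_zero_iff (E := StrongDual 𝕜 (StrongDual 𝕜 X))
  have hC : IsCompact C :=
    ((hs.isCompact_convexHull ℝ).image (toWeakSpaceCLM 𝕜 X).continuous).image J.continuous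
  have hCconv : Convex ℝ C := by
    rintro _ ⟨_, ⟨x, hx, rfl⟩, rfl⟩ _ ⟨_, ⟨y, hy, rfl⟩, rfl⟩ a b ha hb hab
    refine ⟨_, ⟨_, convex_convexHull ℝ s hx hy ha hb hab, rfl⟩, ?_⟩
    simp only [map_add, map_smul, RCLike.real_smul_eq_coe_smul (K := 𝕜),
      WeakDual.real_smul_eq_coe_smul]
  have hBconv : Convex ℝ B := by
    intro x hx y hy a b ha hb hab
    exact convex_closedBall (0 : StrongDual 𝕜 (StrongDual 𝕜 X)) θ hx hy ha hb hab
  have hBC : IsClosed (C + B) :=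
    (hC.add (WeakDual.isCompact_closedBall _ _)).isClosed
  have hnot : StrongDual.toWeakDual z ∉ C + B := by
    rintro ⟨_, ⟨_, ⟨x, -, rfl⟩, rfl⟩, b, hb, hxb⟩
    refine (hz x).not_ge ?_
    have : z = NormedSpace.inclusionInDoubleDual 𝕜 X x + WeakDual.toStrongDual b := hxb.symm
    rw [this]
    exact (congrArg norm (add_sub_cancel_left (NormedSpace.inclusionInDoubleDual 𝕜 X x)
      (WeakDual.toStrongDual b))).trans_le ((hB b).1 hb)
  obtain ⟨f, u, h1, h2⟩ := WeakDual.exists_re_lt_of_notMem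
    (Convex.add (𝕜 := ℝ) (E := WeakDual 𝕜 (StrongDual 𝕜 X)) hCconv hBconv) hBC hnot
  refine ⟨f, u, fun x hx => ?_, h2⟩
  have h3 : θ * ‖f‖ ≤ u - RCLike.re (f x) := mul_norm_le_of_forall_dual hθ fun b hb => by
    have := h1 (J (toWeakSpace 𝕜 X x) + StrongDual.toWeakDual b)
      (add_mem_add ⟨_, ⟨x, hx, rfl⟩, rfl⟩ ((hB _).2 hb))
    have h4 : (J (toWeakSpace 𝕜 X x) + StrongDual.toWeakDual b) f = f x + b f := rfl
    rw [h4, map_add] at this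
    linarith
  linarith

/-- A bounded sequence that is not relatively weakly compact has a subsequence whose successive
convex blocks are separated. -/
theorem exists_separated_convexHull {X : Type*} [NormedAddCommGroup X] [NormedSpace 𝕜 X]
    [NormedSpace ℝ X] [IsScalarTower ℝ 𝕜 X] [CompleteSpace X] {a : ℕ → X}
    (hb : Bornology.IsBounded (range a)) (ha : ¬ IsRelativelyWeaklyCompact 𝕜 (range a)) :
    ∃ θ : ℝ, 0 < θ ∧ ∃ k : ℕ → ℕ, ∀ n, ∀ x ∈ convexHull ℝ (a ∘ k '' Iio n),
      ∀ y ∈ convexHull ℝ (a ∘ k '' Ici n), θ < ‖x - y‖ := by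
  classical
  let J := NormedSpace.inclusionInDoubleDualWeak 𝕜 X
  obtain ⟨z, hz, hzJ⟩ : ∃ z ∈ closure (J '' (toWeakSpace 𝕜 X '' range a)), z ∉ range J := by
    by_contra! hcon
    refine ha (NormedSpace.isCompact_closure_of_isBounded 𝕜 X _ ?_ hcon)
    rwa [preimage_image_eq _ (toWeakSpace 𝕜 X).injective]
  -- By completeness `X` is norm closed in its bidual, so `z` lies at positive distance from it.
  obtain ⟨θ, hθ, hdist⟩ : ∃ θ : ℝ, 0 < θ ∧
      ∀ x : X, θ < ‖WeakDual.toStrongDual z - NormedSpace.inclusionInDoubleDual 𝕜 X x‖ := by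
    have hcl : IsClosed (range (NormedSpace.inclusionInDoubleDual 𝕜 X)) := by
      have hi := (NormedSpace.inclusionInDoubleDualLi (E := X) 𝕜).isometry
      exact (hi.isUniformInducing.isComplete_range).isClosed
    have hmem : WeakDual.toStrongDual z ∉ range (NormedSpace.inclusionInDoubleDual 𝕜 X) := by
      rintro ⟨x, hx⟩
      exact hzJ ⟨toWeakSpace 𝕜 X x, hx⟩
    obtain ⟨ε, hε, hball⟩ := Metric.isOpen_iff.1 hcl.isOpen_compl (WeakDual.toStrongDual z) hmem
    refine ⟨ε / 2, half_pos hε, fun x => ?_⟩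
    by_contra! hcon
    refine hball ?_ ⟨x, rfl⟩
    have h1 := dist_eq_norm (WeakDual.toStrongDual z) (NormedSpace.inclusionInDoubleDual 𝕜 X x)
    rw [mem_ball, dist_comm]
    refine lt_of_eq_of_lt h1 ?_
    linarith
  choose f u hf hu using fun S : Finset ℕ =>
    exists_weakDual_separation hdist hθ.le (S.finite_toSet.image a)
  -- Since `z` is in the weak-star closure of the sequence, one term meets finitely many open
  -- conditions holding at `z`. Asking for all `S' ⊆ S` keeps every earlier separating functional
  -- valid for later terms.
  have hnext : ∀ S : Finset ℕ, ∃ j : ℕ, ∀ S' ⊆ S, u S' < RCLike.re (f S' (a j)) := by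
    intro S
    have hopen : IsOpen (⋂ S' ∈ S.powerset,
        {w : WeakDual 𝕜 (StrongDual 𝕜 X) | u S' < RCLike.re (w (f S'))}) :=
      isOpen_biInter_finset fun S' _ => isOpen_lt continuous_const
        (RCLike.continuous_re.comp (WeakDual.eval_continuous (f S')))
    obtain ⟨_, h1, _, ⟨_, ⟨j, rfl⟩, rfl⟩, rfl⟩ := mem_closure_iff.1 hz _ hopen
      (mem_iInter₂.2 fun S' _ => hu S')
    exact ⟨j, fun S' hS' => mem_iInter₂.1 h1 S' (Finset.mem_powerset.2 hS')⟩
  choose next hnext using hnext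
  let S : ℕ → Finset ℕ := fun n => Nat.rec ∅ (fun _ T => insert (next T) T) n
  have hS : ∀ n, S (n + 1) = insert (next (S n)) (S n) := fun n => rfl
  have hmono : Monotone S := monotone_nat_of_le_succ fun n => by
    rw [hS]
    exact Finset.subset_insert _ _
  refine ⟨θ, hθ, fun n => next (S n), fun n x hx y hy => ?_⟩
  have h1 : RCLike.re (f (S n) x) + θ * ‖f (S n)‖ ≤ u (S n) := by
    refine hf (S n) x (convexHull_mono ?_ hx)
    rintro _ ⟨i, hi, rfl⟩
    exact ⟨next (S i), hmono (Nat.succ_le_of_lt hi) (by rw [hS]; simp), rfl⟩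
  have h2 : u (S n) < RCLike.re (f (S n) y) := by
    have hconv : Convex ℝ {y : X | u (S n) < RCLike.re (f (S n) y)} := by
      refine convex_halfSpace_gt (f := fun y => RCLike.re (f (S n) y)) ⟨?_, ?_⟩ _
      · simp
      · intro c y
        rw [RCLike.real_smul_eq_coe_smul (K := 𝕜), map_smul, smul_eq_mul, RCLike.re_ofReal_mul,
          smul_eq_mul]
    refine convexHull_min ?_ hconv hy
    rintro _ ⟨i, hi, rfl⟩
    exact hnext (S i) (S n) (hmono hi)
  have h3 : RCLike.re (f (S n) y) - RCLike.re (f (S n) x) ≤ ‖f (S n)‖ * ‖x - y‖ := by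
    rw [norm_sub_rev, ← map_sub, ← map_sub]
    exact (RCLike.re_le_norm _).trans ((f (S n)).le_opNorm _)
  refine lt_of_mul_lt_mul_left (a := ‖f (S n)‖) ?_ (norm_nonneg _)
  linarith

end Weak

/-! ### Common stability properties of the two classes of small sets. -/

/-- The properties shared by the classes of relatively compact and of relatively weakly compact
sets. -/
structure IsCompactnessClass (𝕜 : Type*) {F : Type*} [RCLike 𝕜] [NormedAddCommGroup F]
    [NormedSpace 𝕜 F] (p : Set F → Prop) : Prop where
  mono : ∀ {s t : Set F}, p t → s ⊆ t → p s
  add : ∀ {s t : Set F}, p s → p t → p (image2 (· + ·) s t)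
  smul : ∀ (c : 𝕜) {s : Set F}, p s → p ((c • ·) '' s)
  of_isCompact : ∀ {s : Set F}, IsCompact s → p s

section CompactnessClass

variable {𝕜 : Type*} [RCLike 𝕜] {F : Type*} [NormedAddCommGroup F] [NormedSpace 𝕜 F]

variable (𝕜 F) in
theorem isCompactnessClass_isRelativelyCompact :
    IsCompactnessClass 𝕜 (IsRelativelyCompact : Set F → Prop) where
  mono ht hst := ht.mono hst
  add hs ht := hs.add ht
  smul c _ hs := hs.image (continuous_const_smul c)
  of_isCompact hs := hs.closure

variable (𝕜 F) in
theorem isCompactnessClass_isRelativelyWeaklyCompact :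
    IsCompactnessClass 𝕜 (IsRelativelyWeaklyCompact 𝕜 : Set F → Prop) where
  mono ht hst := IsRelativelyCompact.mono ht (image_mono hst)
  add hs ht := by
    refine (IsRelativelyCompact.add hs ht).mono ?_
    rintro _ ⟨_, ⟨x, hx, y, hy, rfl⟩, rfl⟩
    exact ⟨_, ⟨x, hx, rfl⟩, _, ⟨y, hy, rfl⟩, (map_add (toWeakSpace 𝕜 F) _ _).symm⟩
  smul c _ hs := by
    refine (IsRelativelyCompact.image hs (continuous_const_smul c)).mono ?_
    rintro _ ⟨_, ⟨x, hx, rfl⟩, rfl⟩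
    exact ⟨_, ⟨x, hx, rfl⟩, (map_smul (toWeakSpace 𝕜 F) _ _).symm⟩
  of_isCompact hs := (hs.image (toWeakSpaceCLM 𝕜 F).continuous).closure

namespace IsCompactnessClass

variable {p : Set F → Prop} (hp : IsCompactnessClass 𝕜 p) {α : Type*} {B : Set α}
include hp

theorem image_add {f g : α → F} (hf : p (f '' B)) (hg : p (g '' B)) :
    p ((fun x => f x + g x) '' B) := by
  refine hp.mono (hp.add hf hg) ?_
  rintro _ ⟨x, hx, rfl⟩
  exact ⟨f x, ⟨x, hx, rfl⟩, g x, ⟨x, hx, rfl⟩, rfl⟩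

theorem image_smul (c : 𝕜) {f : α → F} (hf : p (f '' B)) : p ((fun x => c • f x) '' B) := by
  refine hp.mono (hp.smul c hf) ?_
  rintro _ ⟨x, hx, rfl⟩
  exact ⟨f x, ⟨x, hx, rfl⟩, rfl⟩

theorem image_sum {ι : Type*} (s : Finset ι) {f : ι → α → F} (hf : ∀ i ∈ s, p (f i '' B)) :
    p ((fun x => ∑ i ∈ s, f i x) '' B) := by
  classical
  induction s using Finset.induction_on with
  | empty =>
    refine hp.mono (hp.of_isCompact (isCompact_singleton (x := (0 : F)))) ?_
    rintro _ ⟨x, -, rfl⟩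
    simp
  | insert i s hi ih =>
    simp only [Finset.sum_insert hi]
    exact hp.image_add (hf i (Finset.mem_insert_self i s))
      (ih fun j hj => hf j (Finset.mem_insert_of_mem hj))

theorem image_smul_const {E : Type*} [NormedAddCommGroup E] [NormedSpace 𝕜 E]
    (f : StrongDual 𝕜 E) (y : F) {B : Set E} (hB : Bornology.IsBounded B) :
    p ((fun x => f x • y) '' B) := by
  have hcomp := (f.lipschitz.isBounded_image hB).isCompact_closure
  have hcont : Continuous fun t : 𝕜 => t • y := continuous_id.smul continuous_const
  refine hp.mono (hp.of_isCompact (hcomp.image hcont)) ?_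
  rintro _ ⟨x, hx, rfl⟩
  exact ⟨f x, subset_closure ⟨x, hx, rfl⟩, rfl⟩

end IsCompactnessClass

end CompactnessClass

/-! ### Extracting a linear coefficient by finite differences. -/

/-- Finite differences which compute the linear coefficient of a polynomial. -/
theorem exists_sum_mul_eval_eq_coeff_one (𝕜 : Type*) [RCLike 𝕜] (n : ℕ) :
    ∃ c : Fin (n + 1) → 𝕜, ∀ m ≤ n, ∑ j, c j * (j : 𝕜) ^ m = if m = 1 then 1 else 0 := by
  -- The nodes `0, …, n` are distinct in characteristic zero, so their Vandermonde matrix is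
  -- invertible.
  have hdet : IsUnit (Matrix.vandermonde fun j : Fin (n + 1) => ((j : ℕ) : 𝕜)) := by
    rw [Matrix.isUnit_iff_isUnit_det, isUnit_iff_ne_zero, Matrix.det_vandermonde_ne_zero_iff]
    exact fun i j h => Fin.ext (Nat.cast_injective (R := 𝕜) h)
  obtain ⟨c, hc⟩ := Matrix.vecMul_surjective_iff_isUnit.2 hdet
    fun m : Fin (n + 1) => if (m : ℕ) = 1 then 1 else 0
  refine ⟨c, fun m hm => ?_⟩
  simpa [Matrix.vecMul, dotProduct, Matrix.vandermonde_apply] using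
    congrFun hc ⟨m, Nat.lt_succ_of_le hm⟩

theorem sum_mul_polynomial_eval {𝕜 : Type*} [RCLike 𝕜] {n : ℕ} {c : Fin (n + 1) → 𝕜}
    (hc : ∀ m ≤ n, ∑ j, c j * (j : 𝕜) ^ m = if m = 1 then 1 else 0) {q : Polynomial 𝕜}
    (hq : q.natDegree ≤ n) : ∑ j, c j * q.eval (j : 𝕜) = q.coeff 1 := by
  simp only [Polynomial.eval_eq_sum_range' (Nat.lt_succ_of_le hq), Finset.mul_sum]
  rw [Finset.sum_comm]
  have : ∀ m ∈ Finset.range (n + 1), ∑ j, c j * (q.coeff m * (j : 𝕜) ^ m) =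
      if m = 1 then q.coeff 1 else 0 := by
    intro m hm
    rw [Finset.sum_congr rfl fun j _ => mul_left_comm (c j) (q.coeff m) _, ← Finset.mul_sum,
      hc m (Nat.le_of_lt_succ (Finset.mem_range.1 hm))]
    split_ifs with h
    · rw [h, mul_one]
    · rw [mul_zero]
  rw [Finset.sum_congr rfl this, Finset.sum_ite_eq']
  split_ifs with h
  · rfl
  · refine (Polynomial.coeff_eq_zero_of_natDegree_lt ?_).symm
    simp only [Finset.mem_range, not_lt] at h
    omega

/-! ### From projections on polynomials to maps on operators. -/

namespace HomogeneousPolynomial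

variable {𝕜 : Type*} {n : ℕ} {E F : Type*} [RCLike 𝕜]
  [NormedAddCommGroup E] [NormedSpace 𝕜 E] [NormedAddCommGroup F] [NormedSpace 𝕜 F]

theorem norm_apply_le (P : HomogeneousPolynomial 𝕜 n E F) (x : E) :
    ‖P x‖ ≤ (‖x‖ + 1) ^ n * ‖P‖ := by
  have hpos : (0 : ℝ) < ‖x‖ + 1 := by positivity
  have hc : ((‖x‖ + 1 : ℝ) : 𝕜) ≠ 0 := RCLike.ofReal_ne_zero.2 hpos.ne'
  have hx : x = ((‖x‖ + 1 : ℝ) : 𝕜) • (((‖x‖ + 1 : ℝ) : 𝕜)⁻¹ • x) := by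
    rw [smul_smul, mul_inv_cancel₀ hc, one_smul]
  have hle : ‖((‖x‖ + 1 : ℝ) : 𝕜)⁻¹ • x‖ ≤ 1 := by
    rw [norm_smul, norm_inv, RCLike.norm_ofReal, abs_of_pos hpos, inv_mul_le_iff₀ hpos]
    linarith
  calc ‖P x‖ = ‖((‖x‖ + 1 : ℝ) : 𝕜) ^ n • P (((‖x‖ + 1 : ℝ) : 𝕜)⁻¹ • x)‖ := by
        rw [← map_smul_pow, ← hx]
    _ = (‖x‖ + 1) ^ n * ‖P (((‖x‖ + 1 : ℝ) : 𝕜)⁻¹ • x)‖ := by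
        rw [norm_smul, norm_pow, RCLike.norm_ofReal, abs_of_pos hpos]
    _ ≤ _ := by gcongr; exact P.le_norm hle

variable (𝕜 n E F) in
/-- Evaluation at a point. -/
noncomputable def evalCLM (x : E) : HomogeneousPolynomial 𝕜 n E F →L[𝕜] F :=
  LinearMap.mkContinuous
    { toFun := fun P => P x
      map_add' := fun _ _ => rfl
      map_smul' := fun _ _ => rfl } ((‖x‖ + 1) ^ n) fun P => P.norm_apply_le x

@[simp] theorem evalCLM_apply (x : E) (P : HomogeneousPolynomial 𝕜 n E F) :
    evalCLM 𝕜 n E F x P = P x := rfl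

/-- The polynomial `x ↦ φ(x)ᵐ T(x)`. -/
def powSMul (φ : StrongDual 𝕜 E) (m : ℕ) (T : E →L[𝕜] F) :
    HomogeneousPolynomial 𝕜 (m + 1) E F where
  toFun x := φ x ^ m • T x
  exists_multilinear := by
    refine ⟨ContinuousLinearMap.uncurryLeft ((ContinuousMultilinearMap.smulRightL 𝕜
      (fun _ : Fin m => E) F
      ((ContinuousMultilinearMap.mkPiAlgebraFin 𝕜 m 𝕜).compContinuousLinearMap
        fun _ => φ)).comp T), fun x => ?_⟩
    simp [Fin.tail]

@[simp] theorem powSMul_apply (φ : StrongDual 𝕜 E) (m : ℕ) (T : E →L[𝕜] F) (x : E) :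
    powSMul φ m T x = φ x ^ m • T x := rfl

/-- `T ↦ φᵐ T` as a continuous linear map. -/
noncomputable def powSMulCLM (φ : StrongDual 𝕜 E) (m : ℕ) :
    (E →L[𝕜] F) →L[𝕜] HomogeneousPolynomial 𝕜 (m + 1) E F :=
  LinearMap.mkContinuous
    { toFun := fun T => powSMul φ m T
      map_add' := fun S T => by ext x; simp
      map_smul' := fun c T => by ext x; simp [smul_comm c] } (‖φ‖ ^ m) fun T => by
    have : Nonempty (closedBall (0 : E) 1) := ⟨⟨0, by simp⟩⟩
    refine ciSup_le fun x => ?_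
    have hx : ‖(x : E)‖ ≤ 1 := mem_closedBall_zero_iff.1 x.2
    have h1 : ‖φ x‖ ≤ ‖φ‖ := by simpa using φ.le_of_opNorm_le_of_le le_rfl hx
    have h2 : ‖T x‖ ≤ ‖T‖ := by simpa using T.le_of_opNorm_le_of_le le_rfl hx
    calc ‖φ x ^ m • T x‖ = ‖φ x‖ ^ m * ‖T x‖ := by rw [norm_smul, norm_pow]
      _ ≤ _ := by gcongr

@[simp] theorem powSMulCLM_apply (φ : StrongDual 𝕜 E) (m : ℕ) (T : E →L[𝕜] F) (x : E) :
    powSMulCLM φ m T x = φ x ^ m • T x := rfl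

/-- The derivative at `e`, as a combination of finite differences. -/
theorem exists_linear_eq_sum {c : Fin (n + 1) → 𝕜}
    (hc : ∀ m ≤ n, ∑ j, c j * (j : 𝕜) ^ m = if m = 1 then 1 else 0)
    (P : HomogeneousPolynomial 𝕜 n E F) (e : E) :
    ∃ D : E →L[𝕜] F, ∀ x, D x = ∑ j, c j • P (e + (j : 𝕜) • x) := by
  obtain ⟨A, hA⟩ := P.exists_multilinear
  refine ⟨(A.linearDeriv fun _ => e).comp (ContinuousLinearMap.pi fun _ => .id 𝕜 E), fun x => ?_⟩
  have h1 : ∀ t : 𝕜, P (e + t • x) =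
      ∑ s : Finset (Fin n), t ^ s.card • A (s.piecewise (fun _ => x) fun _ => e) := by
    intro t
    have h2 : (fun _ : Fin n => e + t • x) = (fun _ => t • x) + fun _ => e := by
      ext i
      simp [add_comm]
    refine (hA _).trans ?_
    rw [h2, A.map_add_univ]
    refine Finset.sum_congr rfl fun s _ => ?_
    have h3 := A.toMultilinearMap.map_piecewise_smul (fun _ => t)
      (s.piecewise (fun _ => x) fun _ => e) s
    rw [Finset.prod_const] at h3
    refine Eq.trans (congrArg A ?_) h3
    ext i
    by_cases hi : i ∈ s <;> simp [hi]
  -- The weights keep only the subsets with one element, which are the terms of the derivative of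
  -- `A` on the diagonal. Writing it through values of `P` is what lets smallness of images pass to
  -- `D`.
  have h4 : ∀ s : Finset (Fin n), ∑ j, c j * (j : 𝕜) ^ s.card = if s.card = 1 then 1 else 0 :=
    fun s => hc _ (by simpa using s.card_le_univ)
  simp only [h1, Finset.smul_sum, smul_smul]
  rw [Finset.sum_comm]
  simp only [← Finset.sum_smul, h4, ite_smul, one_smul, zero_smul]
  rw [← Finset.sum_filter]
  have h5 : (Finset.univ.filter fun s : Finset (Fin n) => s.card = 1) =
      Finset.univ.image fun i : Fin n => ({i} : Finset (Fin n)) := by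
    ext s
    simp [Finset.card_eq_one, eq_comm]
  rw [h5, Finset.sum_image fun i _ j _ h => Finset.singleton_injective h]
  simp [ContinuousMultilinearMap.linearDeriv_apply, Finset.piecewise_singleton]

/-- A projection onto a space of polynomials, given by a class of small sets, induces a
projection onto the corresponding space of operators. -/
theorem exists_linear_of_closedComplemented {m : ℕ} {p : Set F → Prop}
    (hp : IsCompactnessClass 𝕜 p) {𝓟 : Submodule 𝕜 (HomogeneousPolynomial 𝕜 (m + 1) E F)}
    (h𝓟 : ∀ P, P ∈ 𝓟 ↔ ∀ B : Set E, Bornology.IsBounded B → p (P '' B))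
    (hc : 𝓟.ClosedComplemented) (φ : StrongDual 𝕜 E) (e : E) (he : φ e = 1) :
    ∃ Ψ : (E →L[𝕜] F) → E →L[𝕜] F,
      (∀ x, ∃ L : (E →L[𝕜] F) →L[𝕜] F, ∀ T, Ψ T x = L T) ∧
      (∀ T B, Bornology.IsBounded B → p (Ψ T '' B)) ∧
      ∀ T : E →L[𝕜] F, (∀ B, Bornology.IsBounded B → p (T '' B)) → Ψ T = T := by
  obtain ⟨π, hπ⟩ := hc
  obtain ⟨c, hc⟩ := exists_sum_mul_eval_eq_coeff_one 𝕜 (m + 1)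
  choose D hD using fun P : HomogeneousPolynomial 𝕜 (m + 1) E F => P.exists_linear_eq_sum hc e
  let Q : (E →L[𝕜] F) →L[𝕜] HomogeneousPolynomial 𝕜 (m + 1) E F :=
    𝓟.subtypeL.comp (π.comp (powSMulCLM φ m))
  have hQ : ∀ T, Q T ∈ 𝓟 := fun T => (π (powSMulCLM φ m T)).2
  -- At `e` the derivative of `φ^m T` is `x ↦ m φ(x) T e + T x`, as `φ e = 1`. The rank-one
  -- correction removes the first term, since `Q T e = T e` when `Q T = φ^m T`.
  refine ⟨fun T => D (Q T) + (-(m : 𝕜) • φ).smulRight (Q T e), fun x => ?_, fun T B hB => ?_,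
    fun T hT => ?_⟩
  · refine ⟨∑ j, c j • (evalCLM 𝕜 _ E F (e + ((j : ℕ) : 𝕜) • x)).comp Q +
      (-(m : 𝕜) * φ x) • (evalCLM 𝕜 _ E F e).comp Q, fun T => ?_⟩
    simp [hD]
  · have h1 : ∀ j : Fin (m + 1 + 1), p ((fun x => Q T (e + ((j : ℕ) : 𝕜) • x)) '' B) := by
      intro j
      have hb : Bornology.IsBounded ((fun x => e + ((j : ℕ) : 𝕜) • x) '' B) := by
        have := (hB.smul₀ ((j : ℕ) : 𝕜)).vadd e
        refine this.subset ?_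
        rintro _ ⟨x, hx, rfl⟩
        exact ⟨_, ⟨x, hx, rfl⟩, rfl⟩
      have := (h𝓟 _).1 (hQ T) _ hb
      rwa [image_image] at this
    have h2 := hp.image_add (hp.image_sum Finset.univ fun j _ => hp.image_smul (c j) (h1 j))
      (hp.image_smul_const (-(m : 𝕜) • φ) (Q T e) hB)
    refine hp.mono h2 ?_
    rintro _ ⟨x, hx, rfl⟩
    exact ⟨x, hx, by simp [hD]⟩
  · have hmem : powSMulCLM φ m T ∈ 𝓟 := by
      refine (h𝓟 _).2 fun B hB => ?_
      -- `φ(x)^m T x = T (φ(x)^m x)`, so the image of `B` is the image under `T` of another bounded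
      -- set.
      have hb : Bornology.IsBounded ((fun x => φ x ^ m • x) '' B) := by
        obtain ⟨r, hr⟩ := isBounded_iff_forall_norm_le.1 hB
        refine isBounded_iff_forall_norm_le.2 ⟨(‖φ‖ * r) ^ m * r, ?_⟩
        rintro _ ⟨x, hx, rfl⟩
        have hr0 : 0 ≤ r := (norm_nonneg x).trans (hr x hx)
        rw [norm_smul, norm_pow]
        have h1 : ‖φ x‖ ≤ ‖φ‖ * r := φ.le_of_opNorm_le_of_le le_rfl (hr x hx)
        gcongr
        exact hr x hx
      have := hT _ hb
      rw [image_image] at this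
      refine hp.mono this ?_
      rintro _ ⟨x, hx, rfl⟩
      exact ⟨x, hx, by simp⟩
    have hQT : Q T = powSMulCLM φ m T := congrArg Subtype.val (hπ ⟨_, hmem⟩)
    ext x
    -- On the line `e + t x` the polynomial `φ^m T` equals `q(t) (T e + t T x)`; the linear
    -- coefficients of `q` and `X q` are `m φ(x)` and 1.
    let q : Polynomial 𝕜 := (1 + Polynomial.C (φ x) * Polynomial.X) ^ m
    have hq : q.natDegree ≤ m := by
      have h1 : (1 + Polynomial.C (φ x) * Polynomial.X).natDegree ≤ 1 := by
        compute_degree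
      exact (Polynomial.natDegree_pow_le_of_le m h1).trans (mul_one m).le
    have hq1 : ∑ j : Fin (m + 1 + 1), c j * q.eval ((j : ℕ) : 𝕜) = m * φ x := by
      rw [sum_mul_polynomial_eval hc (hq.trans (Nat.le_succ m))]
      have h1 := Polynomial.coeff_derivative q 0
      rw [Polynomial.coeff_zero_eq_eval_zero] at h1
      simpa [q, Polynomial.derivative_pow] using h1.symm
    have hq2 : ∑ j : Fin (m + 1 + 1), c j * (Polynomial.X * q).eval ((j : ℕ) : 𝕜) = 1 := by
      rw [sum_mul_polynomial_eval hc, Polynomial.coeff_X_mul, Polynomial.coeff_zero_eq_eval_zero]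
      · simp [q]
      · refine Polynomial.natDegree_mul_le.trans ?_
        rw [Polynomial.natDegree_X]
        omega
    have hsum : D (Q T) x = (m * φ x) • T e + T x := by
      rw [hD, hQT, ← hq1]
      conv_rhs => rw [← one_smul 𝕜 (T x), ← hq2]
      rw [Finset.sum_smul, Finset.sum_smul, ← Finset.sum_add_distrib]
      refine Finset.sum_congr rfl fun j _ => ?_
      simp only [powSMulCLM_apply, map_add, map_smul, he, q, Polynomial.eval_mul,
        Polynomial.eval_pow, Polynomial.eval_add, Polynomial.eval_one, Polynomial.eval_C,
        Polynomial.eval_X, smul_eq_mul, smul_add, smul_smul]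
      congr 2 <;> ring
    rw [_root_.add_apply, hsum]
    simp [hQT, he]

end HomogeneousPolynomial

/-! ### Coordinate projections and biorthogonal functionals. -/

section Bases

variable {𝕜 : Type*} [RCLike 𝕜]

theorem GeneralSchauderBasis.ext_coord {β G : Type*} [NormedAddCommGroup G] [NormedSpace 𝕜 G]
    {L : SummationFilter β} [L.NeBot] (g : GeneralSchauderBasis β 𝕜 G L) {x y : G}
    (h : ∀ k, g.coord k x = g.coord k y) : x = y := by
  have h1 := g.expansion x
  simp only [h] at h1
  exact h1.unique (g.expansion y)

/-- The bounded family of coordinate projections of an unconditional basis. -/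
theorem UnconditionalSchauderBasis.exists_coordinate_projections {β G : Type*}
    [NormedAddCommGroup G] [NormedSpace 𝕜 G] [CompleteSpace G]
    (g : UnconditionalSchauderBasis β 𝕜 G) :
    ∃ (P : Set β → G →L[𝕜] G) (C : ℝ), (∀ s, ‖P s‖ ≤ C) ∧
      ∀ s k x, g.coord k (P s x) = s.indicator (fun k => g.coord k x) k := by
  classical
  obtain ⟨C, hC⟩ := UnconditionalSchauderBasis.exists_norm_proj_le g
  have hsum : ∀ (s : Set β) (x : G), Summable (s.indicator fun k => g.coord k x • g k) :=
    fun s x => (g.expansion x).summable.indicator s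
  have hbound : ∀ (s : Set β) (x : G),
      ‖∑' k, s.indicator (fun k => g.coord k x • g k) k‖ ≤ C * ‖x‖ := by
    intro s x
    refine le_of_tendsto (hsum s x).hasSum.norm (Filter.Eventually.of_forall fun A => ?_)
    -- Each partial sum of the restricted series is a finite coordinate projection, so the uniform
    -- bound passes to the limit.
    have : ∑ k ∈ A, s.indicator (fun k => g.coord k x • g k) k = g.proj (A.filter (· ∈ s)) x := by
      rw [GeneralSchauderBasis.proj_apply, Finset.sum_filter]
      exact Finset.sum_congr rfl fun k _ => by rw [indicator_apply]
    rw [this]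
    exact (g.proj _).le_of_opNorm_le (hC _) x
  refine ⟨fun s => LinearMap.mkContinuous
    { toFun := fun x => ∑' k, s.indicator (fun k => g.coord k x • g k) k
      map_add' := fun x y => ?_
      map_smul' := fun c x => ?_ } C (hbound s), C, fun s => ?_, fun s k x => ?_⟩
  · rw [← (hsum s x).tsum_add (hsum s y)]
    refine tsum_congr fun k => ?_
    by_cases hk : k ∈ s <;> simp [hk, add_smul]
  · rw [RingHom.id_apply, ← (hsum s x).tsum_const_smul c]
    refine tsum_congr fun k => ?_
    by_cases hk : k ∈ s <;> simp [hk, smul_smul]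
  · refine LinearMap.mkContinuous_norm_le _ ?_ _
    exact (norm_nonneg _).trans (hC ∅)
  · rw [LinearMap.mkContinuous_apply, LinearMap.coe_mk, AddHom.coe_mk,
      (g.coord k).map_tsum (hsum s x), tsum_eq_single k]
    · by_cases hk : k ∈ s <;> simp [hk, g.ortho]
    · intro j hj
      by_cases hjs : j ∈ s <;> simp [hjs, g.ortho, hj.symm]

/-- The coordinate functionals of a seminormalized basic sequence extend to a bounded sequence
of functionals on the whole space. -/
theorem IsSeminormalizedBasicSequence.exists_biorthogonal {F : Type*} [NormedAddCommGroup F]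
    [NormedSpace 𝕜 F] [CompleteSpace F] {x : ℕ → F} (hx : IsSeminormalizedBasicSequence 𝕜 x) :
    ∃ (h : ℕ → StrongDual 𝕜 F) (C : ℝ), (∀ k, ‖h k‖ ≤ C) ∧
      ∀ k j, h k (x j) = if k = j then 1 else 0 := by
  obtain ⟨⟨b, hb⟩, α, _, hα, hαx⟩ := hx
  have : CompleteSpace (Submodule.span 𝕜 (range x)).topologicalClosure :=
    (Submodule.isClosed_topologicalClosure _).completeSpace_coe
  obtain ⟨C, hC⟩ := SchauderBasis.exists_norm_proj_le b
  have hC0 : 0 ≤ C := (norm_nonneg _).trans (hC 0)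
  have hcoord : ∀ k, ‖b.coord k‖ ≤ 2 * C / α := by
    intro k
    refine ContinuousLinearMap.opNorm_le_bound _ (by positivity) fun y => ?_
    -- The `k`-th term is a difference of two partial-sum projections, so it has norm at most
    -- `2C‖y‖`; the lower bound `α` on `‖x k‖` then bounds the coordinate.
    have h1 : b.coord k y • b k = SchauderBasis.proj b (k + 1) y - SchauderBasis.proj b k y := by
      simp [Finset.sum_range_succ]
    have h2 : ‖b.coord k y‖ * ‖x k‖ ≤ 2 * C * ‖y‖ := by
      rw [← hb k, ← Submodule.coe_norm, ← norm_smul, h1]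
      refine (norm_sub_le _ _).trans ?_
      have h3 := (SchauderBasis.proj b (k + 1)).le_of_opNorm_le (hC _) y
      have h4 := (SchauderBasis.proj b k).le_of_opNorm_le (hC _) y
      linarith
    rw [div_mul_eq_mul_div, le_div_iff₀ hα]
    exact (mul_le_mul_of_nonneg_left (hαx k).1.le (norm_nonneg _)).trans h2
  choose h hext hnorm using fun k => exists_extension_norm_eq _ (b.coord k)
  refine ⟨h, 2 * C / α, fun k => (hnorm k).trans_le (hcoord k), fun k j => ?_⟩
  rw [← hb j, hext, b.ortho]
  simp [Pi.single_apply]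

end Bases

/-! ### Domination by a small operator and the contradictions. -/

section Core

variable {𝕜 : Type*} [RCLike 𝕜] {E : Type*} [NormedAddCommGroup E] [NormedSpace 𝕜 E]
  {F : Type*} [NormedAddCommGroup F] [NormedSpace 𝕜 F]

/-- If the space of small polynomials is complemented, then along a subsequence the functionals
`a k` are dominated by the functionals `h k ∘ K` for some small operator `K`. -/
theorem exists_operator_dominating {m : ℕ} {p : Set F → Prop}
    (hp : IsCompactnessClass 𝕜 p) {𝓟 : Submodule 𝕜 (HomogeneousPolynomial 𝕜 (m + 1) E F)}
    (h𝓟 : ∀ P, P ∈ 𝓟 ↔ ∀ B : Set E, Bornology.IsBounded B → p (P '' B))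
    (hc : 𝓟.ClosedComplemented) {T : Set ℕ → E →L[𝕜] F} {C : ℝ}
    (hadd : ∀ s t, Disjoint s t → T (s ∪ t) = T s + T t) (hC : ∀ s, ‖T s‖ ≤ C)
    (hfin : ∀ s : Set ℕ, s.Finite → ∀ B, Bornology.IsBounded B → p (T s '' B))
    {h : ℕ → StrongDual 𝕜 F} {a : ℕ → StrongDual 𝕜 E}
    (ha : ∀ s k x, h k (T s x) = s.indicator (fun k => a k x) k) :
    ∃ (K : E →L[𝕜] F) (v : ℕ → ℕ), StrictMono v ∧
      (∀ B, Bornology.IsBounded B → p (K '' B)) ∧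
      ∀ ξ : ℕ →₀ 𝕜, ‖Finsupp.linearCombination 𝕜 (a ∘ v) ξ‖ ≤
        4 * ‖Finsupp.linearCombination 𝕜 (fun k => (h (v k)).comp K) ξ‖ := by
  -- The zero space has no `φ`, `e` with `φ e = 1`, but there the inequality is trivial.
  rcases subsingleton_or_nontrivial E with hE | hE
  · refine ⟨T ∅, id, strictMono_id, hfin ∅ finite_empty, fun ξ => ?_⟩
    rw [show Finsupp.linearCombination 𝕜 (a ∘ id) ξ = 0 by
      ext x; rw [Subsingleton.elim x 0, map_zero, map_zero]]
    simp
  obtain ⟨e₀, he₀⟩ := exists_ne (0 : E)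
  obtain ⟨φ, -, hφ⟩ := exists_dual_vector 𝕜 e₀ (norm_ne_zero_iff.2 he₀)
  have hne : φ e₀ ≠ 0 := by
    rw [hφ]
    exact RCLike.ofReal_ne_zero.2 (norm_ne_zero_iff.2 he₀)
  obtain ⟨Ψ, hΨ, hΨp, hΨT⟩ := HomogeneousPolynomial.exists_linear_of_closedComplemented hp h𝓟 hc φ
    ((φ e₀)⁻¹ • e₀) (by rw [map_smul, smul_eq_mul, inv_mul_cancel₀ hne])
  choose L hL using hΨ
  obtain ⟨x, hx⟩ := exists_seq_norming a
  -- The countable index set runs over pairs of a functional `h k` and a norming point `x i`; the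
  -- defect vanishes on finite sets because `Ψ` fixes small operators.
  obtain ⟨s, hs, hμ⟩ := exists_infinite_forall_eq_zero
    (μ := fun (i : ℕ × ℕ) s => h i.1 (Ψ (T s) (x i.2)) - h i.1 (T s (x i.2)))
    (fun i s t hst => by simp only [hL, hadd s t hst, map_add, _root_.add_apply]; ring)
    (fun i s hs => by simp only [hΨT _ (hfin s hs), sub_self])
    (fun i => by
      let l : (E →L[𝕜] F) →L[𝕜] 𝕜 := (h i.1).comp (L (x i.2) -
        ContinuousLinearMap.apply 𝕜 F (x i.2))
      refine ⟨‖l‖ * C, fun s => ?_⟩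
      have : h i.1 (Ψ (T s) (x i.2)) - h i.1 (T s (x i.2)) = l (T s) := by simp [l, hL]
      rw [this]
      exact l.le_of_opNorm_le_of_le le_rfl (hC s))
  obtain ⟨v, hv, hvs⟩ : ∃ v : ℕ → ℕ, StrictMono v ∧ ∀ k, v k ∈ s :=
    ⟨Nat.nth (· ∈ s), Nat.nth_strictMono hs, Nat.nth_mem_of_infinite hs⟩
  refine ⟨Ψ (T s), v, hv, hΨp _, fun ξ => ?_⟩
  refine hx _ ?_ _ fun i => ?_
  · refine Submodule.span_mono (range_comp_subset_range v a) ?_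
    rw [← Finsupp.range_linearCombination]
    exact LinearMap.mem_range_self _ ξ
  · simp only [Finsupp.linearCombination_apply, Finsupp.sum, _root_.sum_apply]
    refine Finset.sum_congr rfl fun k _ => ?_
    have h1 := sub_eq_zero.1 (hμ (v k, i))
    dsimp only at h1
    rw [ha, indicator_of_mem (hvs k)] at h1
    simp [← h1]

theorem exists_separated_subsequence {X : Type*} [PseudoMetricSpace X] [CompleteSpace X] {a : ℕ → X}
    (ha : ¬ IsRelativelyCompact (range a)) :
    ∃ ε : ℝ, 0 < ε ∧ ∃ u : ℕ → ℕ, ∀ i j, i < j → ε ≤ dist (a (u i)) (a (u j)) := by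
  have h1 : ¬ TotallyBounded (range a) := fun h =>
    ha (h.closure.isCompact_of_isClosed isClosed_closure)
  rw [Metric.totallyBounded_iff] at h1
  push Not at h1
  obtain ⟨ε, hε, hcov⟩ := h1
  obtain ⟨u, -, hu⟩ := exists_seq_of_forall_finset_exists (fun _ : ℕ => True)
    (fun i j => ε ≤ dist (a i) (a j)) fun s _ => by
      have h2 := hcov (a '' s) (s.finite_toSet.image a)
      rw [not_subset] at h2
      obtain ⟨_, ⟨j, rfl⟩, hj⟩ := h2
      refine ⟨j, trivial, fun i hi => ?_⟩
      by_contra! hlt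
      exact hj (mem_biUnion ⟨i, hi, rfl⟩ (by rwa [mem_ball, dist_comm]))
  exact ⟨ε, hε, u, hu⟩

/-- Composing a bounded sequence of functionals with a compact operator gives a sequence
without separated subsequences. -/
theorem exists_norm_comp_sub_lt {K : E →L[𝕜] F} (hK : IsRelativelyCompact (K '' closedBall 0 1))
    {h : ℕ → StrongDual 𝕜 F} {C : ℝ} (hC : ∀ k, ‖h k‖ ≤ C) {δ : ℝ} (hδ : 0 < δ) :
    ∃ i j, i < j ∧ ‖(h i).comp K - (h j).comp K‖ ≤ δ := by
  have hC0 : 0 ≤ C := (norm_nonneg _).trans (hC 0)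
  -- On a finite net the `h k` form a bounded set in a finite-dimensional space, so a subsequence is
  -- Cauchy there. The errors `δ/8 + δ/8 + δ/4`, doubled by `exists_half_norm_le`, total `δ`.
  obtain ⟨t, ht, htK⟩ := Metric.totallyBounded_iff.1
    (hK.totallyBounded.subset subset_closure) (δ / (8 * (C + 1))) (by positivity)
  have := ht.fintype
  have hb : Bornology.IsBounded (range fun k (y : t) => h k y) := by
    refine Bornology.forall_isBounded_image_eval_iff.1 fun y => ?_
    refine isBounded_iff_forall_norm_le.2 ⟨C * ‖(y : F)‖, ?_⟩
    rintro _ ⟨_, ⟨k, rfl⟩, rfl⟩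
    exact (h k).le_of_opNorm_le (hC k) y
  have hcompact := hb.isCompact_closure
  obtain ⟨w, -, v, hv, hlim⟩ := hcompact.tendsto_subseq (x := fun k (y : t) => h k y)
    fun k => subset_closure ⟨k, rfl⟩
  obtain ⟨N, hN⟩ := Metric.cauchySeq_iff'.1 hlim.cauchySeq (δ / 4) (by positivity)
  refine ⟨v N, v (N + 1), hv (Nat.lt_succ_self N), ?_⟩
  obtain ⟨x, hx, hfx⟩ := ((h (v N)).comp K - (h (v (N + 1))).comp K).exists_half_norm_le
  obtain ⟨z, hz, hxz⟩ := mem_iUnion₂.1 (htK ⟨x, by simpa using hx, rfl⟩)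
  rw [mem_ball, dist_eq_norm] at hxz
  have h1 : ∀ k, ‖h k (K x - z)‖ ≤ δ / 8 := by
    intro k
    refine ((h k).le_of_opNorm_le_of_le (hC k) hxz.le).trans ?_
    rw [mul_div_assoc', div_le_div_iff₀ (by positivity) (by positivity)]
    nlinarith
  have h2 : ‖h (v (N + 1)) z - h (v N) z‖ ≤ δ / 4 := by
    rw [← dist_eq_norm]
    exact (dist_le_pi_dist (fun y : t => h (v (N + 1)) y) (fun y : t => h (v N) y) ⟨z, hz⟩).trans
      (hN (N + 1) (Nat.le_succ N)).le
  have h3 : ((h (v N)).comp K - (h (v (N + 1))).comp K) x =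
      h (v N) (K x - z) - h (v (N + 1)) (K x - z) - (h (v (N + 1)) z - h (v N) z) := by
    simp
    ring
  rw [h3] at hfx
  have h4 := norm_sub_le (h (v N) (K x - z) - h (v (N + 1)) (K x - z))
    (h (v (N + 1)) z - h (v N) z)
  have h5 := norm_sub_le (h (v N) (K x - z)) (h (v (N + 1)) (K x - z))
  linarith [h1 (v N), h1 (v (N + 1))]

theorem exists_operator_family {G : Type*} [NormedAddCommGroup G] [NormedSpace 𝕜 G]
    [CompleteSpace G] [CompleteSpace F] (g : UnconditionalSchauderBasis ℕ 𝕜 G)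
    {R : G →L[𝕜] F} (hR : IsSeminormalizedBasicSequence 𝕜 fun k => R (g k)) (S : E →L[𝕜] G) :
    ∃ (T : Set ℕ → E →L[𝕜] F) (h : ℕ → StrongDual 𝕜 F) (C : ℝ),
      (∀ s t, Disjoint s t → T (s ∪ t) = T s + T t) ∧ (∀ s, ‖T s‖ ≤ C) ∧
      (∀ s : Set ℕ, s.Finite → ∀ p : Set F → Prop, IsCompactnessClass 𝕜 p →
        ∀ B, Bornology.IsBounded B → p (T s '' B)) ∧
      (∀ k, ‖h k‖ ≤ C) ∧ (∀ k, ‖(g.coord k).comp S‖ ≤ C) ∧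
      ∀ s k x, h k (T s x) = s.indicator (fun k => (g.coord k).comp S x) k := by
  classical
  obtain ⟨P, C₁, hC₁, hP⟩ := UnconditionalSchauderBasis.exists_coordinate_projections g
  obtain ⟨h, C₂, hC₂, hh⟩ := hR.exists_biorthogonal
  have hhR : ∀ k x, h k (R x) = g.coord k x := by
    intro k x
    have h1 := (g.expansion x).mapL ((h k).comp R)
    have h2 := (g.expansion x).mapL (g.coord k)
    refine h1.unique ?_
    convert h2 using 2 with j
    simp [hh, g.ortho, Pi.single_apply]
  have hT : ∀ s k x, h k ((R.comp ((P s).comp S)) x) =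
      s.indicator (fun k => (g.coord k).comp S x) k := by
    intro s k x
    simp only [ContinuousLinearMap.comp_apply, hhR, hP]
  have hC₁0 : 0 ≤ C₁ := (norm_nonneg _).trans (hC₁ ∅)
  have hTC : ∀ s, ‖R.comp ((P s).comp S)‖ ≤ ‖R‖ * (C₁ * ‖S‖) := fun s =>
    (R.opNorm_comp_le _).trans (mul_le_mul_of_nonneg_left
      (((P s).opNorm_comp_le S).trans (mul_le_mul_of_nonneg_right (hC₁ s) (norm_nonneg _)))
      (norm_nonneg _))
  have hC₂0 : 0 ≤ C₂ := (norm_nonneg _).trans (hC₂ 0)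
  have hD0 : 0 ≤ ‖R‖ * (C₁ * ‖S‖) := by positivity
  refine ⟨fun s => R.comp ((P s).comp S), h, ‖R‖ * (C₁ * ‖S‖) + C₂ + C₂ * (‖R‖ * (C₁ * ‖S‖)),
    fun s t hst => ?_, fun s => ?_, fun s hs p hp B hB => ?_, fun k => ?_, fun k => ?_, hT⟩
  · ext x
    simp only [_root_.add_apply, ContinuousLinearMap.comp_apply]
    rw [← map_add]
    refine congrArg R (g.ext_coord fun k => ?_)
    rw [map_add]
    simp only [hP]
    rw [indicator_union_of_disjoint hst]
  · have : 0 ≤ C₂ * (‖R‖ * (C₁ * ‖S‖)) := by positivity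
    linarith [hTC s]
  · have h1 : ∀ x, R (P s (S x)) = ∑ k ∈ hs.toFinset, (g.coord k).comp S x • R (g k) := by
      intro x
      simp only [← map_smul, ← map_sum]
      refine congrArg R (g.ext_coord fun k => ?_)
      rw [hP, map_sum]
      by_cases hk : k ∈ s
      · rw [Finset.sum_eq_single k]
        · simp [hk, g.ortho]
        · intro j _ hj
          simp [g.ortho, hj.symm]
        · simp [hk]
      · rw [Finset.sum_eq_zero]
        · simp [hk]
        · intro j hj
          have : k ≠ j := fun h => hk (h ▸ hs.mem_toFinset.1 hj)
          simp [g.ortho, this]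
    have h2 := hp.image_sum hs.toFinset fun k _ =>
      hp.image_smul_const ((g.coord k).comp S) (R (g k)) hB
    refine hp.mono h2 ?_
    rintro _ ⟨x, hx, rfl⟩
    exact ⟨x, hx, (h1 x).symm⟩
  · have : 0 ≤ C₂ * (‖R‖ * (C₁ * ‖S‖)) := by positivity
    linarith [hC₂ k]
  -- Taking `s = ℕ` bounds the `a k` through `h k`, with no normalization of the basis `g` itself.
  · have h1 : (g.coord k).comp S = (h k).comp (R.comp ((P univ).comp S)) := by
      ext x
      have := hT univ k x
      rw [indicator_univ] at this
      exact this.symm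
    rw [h1]
    have h2 : ‖(h k).comp (R.comp ((P univ).comp S))‖ ≤ C₂ * (‖R‖ * (C₁ * ‖S‖)) :=
      ((h k).opNorm_comp_le _).trans (mul_le_mul (hC₂ k) (hTC _) (norm_nonneg _) hC₂0)
    linarith

/-- The separated subsequence `u` has to be fixed before `s` is chosen: separation survives passing
to the further subsequence `v`, whereas failure of relative compactness need not. Relabelling the
sets through `u` achieves this. -/
theorem exists_operator_dominating_of_basis {G : Type*} [NormedAddCommGroup G] [NormedSpace 𝕜 G]
    [CompleteSpace G] [CompleteSpace F] (g : UnconditionalSchauderBasis ℕ 𝕜 G)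
    {R : G →L[𝕜] F} (hR : IsSeminormalizedBasicSequence 𝕜 fun k => R (g k)) (S : E →L[𝕜] G)
    {m : ℕ} {p : Set F → Prop} (hp : IsCompactnessClass 𝕜 p)
    {𝓟 : Submodule 𝕜 (HomogeneousPolynomial 𝕜 (m + 1) E F)}
    (h𝓟 : ∀ P, P ∈ 𝓟 ↔ ∀ B : Set E, Bornology.IsBounded B → p (P '' B))
    (hc : 𝓟.ClosedComplemented) {u : ℕ → ℕ} (hu : Function.Injective u) :
    ∃ (K : E →L[𝕜] F) (v : ℕ → ℕ) (h : ℕ → StrongDual 𝕜 F) (C : ℝ), StrictMono v ∧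
      (∀ k, ‖h k‖ ≤ C) ∧ (∀ B, Bornology.IsBounded B → p (K '' B)) ∧
      ∀ ξ : ℕ →₀ 𝕜, ‖Finsupp.linearCombination 𝕜 (fun k => (g.coord (u (v k))).comp S) ξ‖ ≤
        4 * ‖Finsupp.linearCombination 𝕜 (fun k => (h k).comp K) ξ‖ := by
  obtain ⟨T, h, C, hadd, hTC, hfin, hhC, -, ha⟩ := exists_operator_family g hR S
  obtain ⟨K, v, hv, hK, hdom⟩ := exists_operator_dominating hp h𝓟 hc
    (T := fun s => T (u '' s)) (C := C) (h := h ∘ u) (a := fun k => (g.coord (u k)).comp S)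
    (fun s t hst => by rw [image_union, hadd _ _ ((disjoint_image_iff hu).2 hst)])
    (fun s => hTC _) (fun s hs => hfin _ (hs.image u) p hp)
    (fun s k x => by
      rw [Function.comp_apply, ha]
      by_cases hk : k ∈ s
      · rw [indicator_of_mem hk, indicator_of_mem (mem_image_of_mem u hk)]
      · rw [indicator_of_notMem hk, indicator_of_notMem (by rwa [hu.mem_set_image])])
  exact ⟨K, v, fun k => h (u (v k)), C, hv, fun k => hhC _, hK, hdom⟩

theorem not_closedComplemented_compactPolynomials {G : Type*} [NormedAddCommGroup G]
    [NormedSpace 𝕜 G] [CompleteSpace G] [CompleteSpace F] (g : UnconditionalSchauderBasis ℕ 𝕜 G)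
    {R : G →L[𝕜] F} (hR : IsSeminormalizedBasicSequence 𝕜 fun k => R (g k)) {S : E →L[𝕜] G}
    (hS : ¬ IsRelativelyCompact (range fun k => (g.coord k).comp S)) (m : ℕ) :
    ¬ (HomogeneousPolynomial.compactPolynomials 𝕜 (m + 1) E F).ClosedComplemented := by
  intro hc
  obtain ⟨ε, hε, u, hu⟩ := exists_separated_subsequence hS
  have hinj : Function.Injective u := by
    intro i j hij
    by_contra hne
    rcases lt_or_gt_of_ne hne with hlt | hlt
    · exact absurd (hu i j hlt) (by simp [hij, hε])
    · exact absurd (hu j i hlt) (by simp [hij, hε])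
  obtain ⟨K, v, h, C, hv, hC, hK, hdom⟩ := exists_operator_dominating_of_basis g hR S
    (isCompactnessClass_isRelativelyCompact 𝕜 F) (fun P => Iff.rfl) hc hinj
  -- The domination constant 4 turns `ε / 5` into `4ε / 5 < ε`.
  obtain ⟨i, j, hij, hlt⟩ := exists_norm_comp_sub_lt (hK _ isBounded_closedBall) hC
    (show 0 < ε / 5 by positivity)
  have h1 := hdom (Finsupp.single i 1 - Finsupp.single j 1)
  simp only [map_sub, Finsupp.linearCombination_single, one_smul] at h1
  have h2 := hu _ _ (hv hij)
  rw [dist_eq_norm] at h2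
  linarith

theorem not_closedComplemented_weaklyCompactPolynomials {G : Type*} [NormedAddCommGroup G]
    [NormedSpace 𝕜 G] [CompleteSpace G] [CompleteSpace F] (g : UnconditionalSchauderBasis ℕ 𝕜 G)
    {R : G →L[𝕜] F} (hR : IsSeminormalizedBasicSequence 𝕜 fun k => R (g k)) {S : E →L[𝕜] G}
    (hS : ¬ IsRelativelyWeaklyCompact 𝕜 (range fun k => (g.coord k).comp S)) (m : ℕ) :
    ¬ (HomogeneousPolynomial.weaklyCompactPolynomials 𝕜 (m + 1) E F).ClosedComplemented := by
  intro hc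
  have hbdd : Bornology.IsBounded (range fun k => (g.coord k).comp S) := by
    obtain ⟨-, -, C, -, -, -, -, hC, -⟩ := exists_operator_family g hR S
    exact isBounded_iff_forall_norm_le.2 ⟨C, forall_mem_range.2 hC⟩
  obtain ⟨θ, hθ, u, hu⟩ := exists_separated_convexHull hbdd hS
  have hinj : Function.Injective u := by
    have key : ∀ i j, i < j → u i ≠ u j := by
      intro i j hij heq
      have := hu j _ (subset_convexHull ℝ _ ⟨i, hij, rfl⟩) _
        (subset_convexHull ℝ _ ⟨j, self_mem_Ici, rfl⟩)
      simp only [Function.comp_apply, heq, sub_self, norm_zero] at this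
      exact lt_asymm hθ this
    intro i j hij
    by_contra hne
    rcases lt_or_gt_of_ne hne with hlt | hlt
    · exact key i j hlt hij
    · exact key j i hlt hij.symm
  obtain ⟨K, v, h, C, hv, hC, hK, hdom⟩ := exists_operator_dominating_of_basis g hR S
    (isCompactnessClass_isRelativelyWeaklyCompact 𝕜 F) (fun P => Iff.rfl) hc hinj
  obtain ⟨n, x, hx, y, hy, hxy⟩ := exists_convexHull_norm_sub_lt
    (fun r => hK _ isBounded_closedBall) hC (show 0 < θ / 4 by positivity)
  -- Close convex blocks of `h k ∘ K` are lifted to coefficient vectors `ξ`, `η`. The same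
  -- coefficients give convex blocks of the `a k`, which domination makes closer than `θ`.
  let α : (ℕ →₀ 𝕜) →ₗ[ℝ] StrongDual 𝕜 E := (Finsupp.linearCombination 𝕜
    fun k => (g.coord (u (v k))).comp S).restrictScalars ℝ
  let β : (ℕ →₀ 𝕜) →ₗ[ℝ] StrongDual 𝕜 E := (Finsupp.linearCombination 𝕜
    fun k => (h k).comp K).restrictScalars ℝ
  have hβ : ∀ s : Set ℕ, (fun k => (h k).comp K) '' s =
      β '' ((fun k => Finsupp.single k 1) '' s) := by
    intro s
    rw [image_image]
    simp [β]
  have hα : ∀ s : Set ℕ, α '' ((fun k => Finsupp.single k 1) '' s) =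
      (fun k => (g.coord (u (v k))).comp S) '' s := by
    intro s
    rw [image_image]
    simp [α]
  rw [hβ, ← β.image_convexHull] at hx hy
  obtain ⟨ξ, hξ, rfl⟩ := hx
  obtain ⟨η, hη, rfl⟩ := hy
  have hξ' := mem_image_of_mem α hξ
  have hη' := mem_image_of_mem α hη
  rw [α.image_convexHull, hα] at hξ' hη'
  have h1 := hu (v n) (α ξ) (convexHull_mono (by
      rintro _ ⟨k, hk, rfl⟩
      exact ⟨v k, hv hk, rfl⟩) hξ') (α η) (convexHull_mono (by
      rintro _ ⟨k, hk, rfl⟩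
      exact ⟨v k, hv.monotone hk, rfl⟩) hη')
  have h2 := hdom (ξ - η)
  rw [map_sub, map_sub] at h2
  have h3 : ‖α ξ - α η‖ ≤ 4 * ‖β ξ - β η‖ := h2
  linarith

end Core

theorem mainTheorem3 {𝕜 : Type*} [RCLike 𝕜]
    {E : Type*} [NormedAddCommGroup E] [NormedSpace 𝕜 E] [CompleteSpace E]
    {F : Type*} [NormedAddCommGroup F] [NormedSpace 𝕜 F] [CompleteSpace F]
    {G : Type*} [NormedAddCommGroup G] [NormedSpace 𝕜 G] [CompleteSpace G]
    (g : UnconditionalSchauderBasis ℕ 𝕜 G) :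
    ((∃ (R : G →L[𝕜] F) (S : E →L[𝕜] G),
        IsSeminormalizedBasicSequence 𝕜 (fun k => R (g k)) ∧
        ¬ IsRelativelyCompact (Set.range fun k => (g.coord k).comp S)) →
      ∀ n : ℕ, 1 ≤ n →
        ¬ (HomogeneousPolynomial.compactPolynomials 𝕜 n E F).ClosedComplemented) ∧
    ((∃ (R : G →L[𝕜] F) (S : E →L[𝕜] G),
        IsSeminormalizedBasicSequence 𝕜 (fun k => R (g k)) ∧
        ¬ IsRelativelyWeaklyCompact 𝕜 (Set.range fun k => (g.coord k).comp S)) →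
      ∀ n : ℕ, 1 ≤ n →
        ¬ (HomogeneousPolynomial.weaklyCompactPolynomials 𝕜 n E F).ClosedComplemented) := by
  refine ⟨?_, ?_⟩
  · rintro ⟨R, S, hR, hS⟩ n hn
    obtain ⟨m, rfl⟩ := Nat.exists_eq_add_of_le' hn
    exact not_closedComplemented_compactPolynomials g hR hS m
  · rintro ⟨R, S, hR, hS⟩ n hn
    obtain ⟨m, rfl⟩ := Nat.exists_eq_add_of_le' hn
    exact not_closedComplemented_weaklyCompactPolynomials g hR hS m
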